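/- Let $n\ge 1$, $\mathbb D=\{z\in\mathbb C:|z|<1\}$, $\mathbb T=\{\zeta\in\mathbb C:|\zeta|=1\}$, and let $m_n$ be the normalized Haar measure on $\mathbb T^n$; $L^p(\mathbb T^n)$ denotes $L^p(\mathbb T^n,m_n)$ with complex values. Let $\alpha,\beta\in\mathbb C^n$ satisfy $$\Re\alpha_j+\Re\beta_j>-1,\qquad \alpha_j,\beta_j\notin\{-1,-2,-3,\dots\}\qquad(1\le j\le n).$$ Let $sh_{\alpha,\beta}(\mathbb D^n)$ be the space of all functions $u:\mathbb D^n\to\mathbb C$ of class $C^2$ (in the real sense) such that, for every $1\le j\le n$ and every $z\in\mathbb D^n$, $$(1-|z_j|^2)\frac{\partial^2u}{\partial z_j\partial\overline{z_j}}(z)+\alpha_jz_j\frac{\partial u}{\partial z_j}(z)+\beta_j\overline{z_j}\frac{\partial u}{\partial\overline{z_j}}(z)-\alpha_j\beta_ju(z)=0,$$ where $\frac{\partial}{\partial z_j}=\frac12\left(\frac{\partial}{\partial x_j}-i\frac{\partial}{\partial y_j}\right)$ and $\frac{\partial}{\partial\overline{z_j}}=\frac12\left(\frac{\partial}{\partial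 x_j}+i\frac{\partial}{\partial y_j}\right)$ for $z_j=x_j+iy_j$. For $z\in\mathbb D^n$ and $\zeta\in\mathbb T^n$ put $$P_{\alpha,\beta}(z,\zeta)=\prod_{j=1}^n\frac{\Gamma(\alpha_j+1)\Gamma(\beta_j+1)}{\Gamma(\alpha_j+\beta_j+1)}\,\frac{(1-|z_j|^2)^{\alpha_j+\beta_j+1}}{(1-z_j\overline{\zeta_j})^{\alpha_j+1}(1-\overline{z_j}\zeta_j)^{\beta_j+1}}$$ (principal branches of the powers), and for $\psi\in L^1(\mathbb T^n)$ put $$P_{\alpha,\beta}[\psi](z)=\int_{\mathbb T^n}P_{\alpha,\beta}(z,\zeta)\psi(\zeta)\,dm_n(\zeta),\qquad z\in\mathbb D^n.$$ For $0\le r<1$ let $u_r(\zeta)=u(r\zeta_1,\dots,r\zeta_n)$, $\zeta\in\mathbb T^n$. Let $1<p\le\infty$ and let $u\in sh_{\alpha,\beta}(\mathbb D^n)$ satisfy $$\sup_{0\le r<1}\|u_r\|_{L^p(\mathbb T^n)}<\infty.$$ Then there exists a unique $\psi\in L^p(\mathbb T^n)$ such that $u=P_{\alpha,\beta}[\psi]$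 on $\mathbb D^n$. -/

import Mathlib

open MeasureTheory
open scoped ENNReal ComplexConjugate

noncomputable section

/-! ### Differential operators and separately `(α, β)`-harmonic functions -/

/-- The open unit polydisc `𝔻ⁿ` in `ℂⁿ`. -/
def polydisc (n : ℕ) : Set (Fin n → ℂ) := {z | ∀ j, ‖z j‖ < 1}

/-- The Wirtinger derivative `∂u/∂z_j = (1/2) (∂u/∂x_j - i ∂u/∂y_j)`. -/
def dz {n : ℕ} (j : Fin n) (u : (Fin n → ℂ) → ℂ) (z : Fin n → ℂ) : ℂ :=
  (1 / 2 : ℂ) *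
    (fderiv ℝ u z (Pi.single j 1) - Complex.I * fderiv ℝ u z (Pi.single j Complex.I))

/-- The Wirtinger derivative `∂u/∂z̄_j = (1/2) (∂u/∂x_j + i ∂u/∂y_j)`. -/
def dzbar {n : ℕ} (j : Fin n) (u : (Fin n → ℂ) → ℂ) (z : Fin n → ℂ) : ℂ :=
  (1 / 2 : ℂ) *
    (fderiv ℝ u z (Pi.single j 1) + Complex.I * fderiv ℝ u z (Pi.single j Complex.I))

/-- The operator `L_{a,b}` acting in the `j`-th variable:
`(1 - |z_j|²) ∂²u/∂z_j∂z̄_j + a z_j ∂u/∂z_j + b z̄_j ∂u/∂z̄_j - a b u`. -/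
def opL {n : ℕ} (j : Fin n) (a b : ℂ) (u : (Fin n → ℂ) → ℂ) (z : Fin n → ℂ) : ℂ :=
  (1 - (‖z j‖ : ℂ) ^ 2) * dz j (dzbar j u) z + a * z j * dz j u z
    + b * conj (z j) * dzbar j u z - a * b * u z

/-- `u` restricted to the polydisc is a separately `(α, β)`-harmonic function: it is of class `C²`
(in the real sense) there and is annihilated by all the operators `L_{α_j,β_j}`.
Values of `u` outside the polydisc play no role. -/
def IsSepHarmonic {n : ℕ} (α β : Fin n → ℂ) (u : (Fin n → ℂ) → ℂ) : Prop :=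
  ContDiffOn ℝ 2 u (polydisc n) ∧
    ∀ j : Fin n, ∀ z ∈ polydisc n, opL j (α j) (β j) u z = 0

/-! ### The torus and its normalized Haar measure -/

instance circleMeasurableSpace : MeasurableSpace Circle := borel Circle

instance circleBorelSpace : BorelSpace Circle := ⟨rfl⟩

/-- The unit torus `𝕋ⁿ` (the distinguished boundary of the polydisc). -/
abbrev Torus (n : ℕ) : Type := Fin n → Circle

/-- The normalized Haar measure on the unit circle. -/
def circleHaar : Measure Circle := Measure.haarMeasure ⊤

instance circleHaar_isHaarMeasure : circleHaar.IsHaarMeasure :=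
  Measure.isHaarMeasure_haarMeasure _

instance circleHaar_isProbabilityMeasure : IsProbabilityMeasure circleHaar :=
  ⟨by simpa [circleHaar] using
    Measure.haarMeasure_self (K₀ := (⊤ : TopologicalSpace.PositiveCompacts Circle))⟩

/-- The normalized Haar measure `m_n` on `𝕋ⁿ`: the product of the normalized Haar measures on
the factors. -/
def torusHaar (n : ℕ) : Measure (Torus n) := Measure.pi fun _ => circleHaar

instance torusHaar_isHaarMeasure (n : ℕ) : (torusHaar n).IsHaarMeasure :=
  Measure.pi.isHaarMeasure _

instance torusHaar_isProbabilityMeasure (n : ℕ) : IsProbabilityMeasure (torusHaar n) :=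
  inferInstanceAs (IsProbabilityMeasure (Measure.pi fun _ => circleHaar))

/-- The dilation `u_r(ζ) = u(r ζ₁, …, r ζ_n)` as a function on the torus. -/
def dilate {n : ℕ} (u : (Fin n → ℂ) → ℂ) (r : ℝ) (ζ : Torus n) : ℂ :=
  u fun j => (r : ℂ) * (ζ j : ℂ)

/-! ### The `(α, β)`-Poisson kernel and Poisson integral -/

/-- The constant `c_{a,b} = Γ(a+1) Γ(b+1) / Γ(a+b+1)`. -/
def poissonConst (a b : ℂ) : ℂ :=
  Complex.Gamma (a + 1) * Complex.Gamma (b + 1) / Complex.Gamma (a + b + 1)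

/-- The `(α, β)`-Poisson kernel
`P_{α,β}(z, ζ) = ∏_j c_{α_j,β_j} (1-|z_j|²)^{α_j+β_j+1} /
  ((1 - z_j ζ̄_j)^{α_j+1} (1 - z̄_j ζ_j)^{β_j+1})`.
For `z` in the polydisc all bases have positive real part; the powers are principal branches. -/
def poissonKernelAB {n : ℕ} (α β : Fin n → ℂ) (z : Fin n → ℂ) (ζ : Torus n) : ℂ :=
  ∏ j, poissonConst (α j) (β j) *
    ((1 - (‖z j‖ : ℂ) ^ 2) ^ (α j + β j + 1) /
      ((1 - z j * conj (ζ j : ℂ)) ^ (α j + 1) * (1 - conj (z j) * (ζ j : ℂ)) ^ (β j + 1)))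

/-- The Poisson integral `P_{α,β}[f](z) = ∫ P_{α,β}(z, ζ) f(ζ) dm_n(ζ)` of an integrable
function `f` on the torus. -/
def poissonIntegralAB {n : ℕ} (α β : Fin n → ℂ) (f : Torus n → ℂ) (z : Fin n → ℂ) : ℂ :=
  ∫ ζ, poissonKernelAB α β z ζ * f ζ ∂(torusHaar n)

end

/-! Everything is read off from Fourier coefficients on the tori of radii `r`. The operators commute
with rotations, so integrating `L_j u = 0` against a character leaves, for each `j`, a linear
second-order ODE in `log r_j` whose coefficients involve only `r_j`, `k_j`, `α_j`, `β_j`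
(`coeff_radial_equation`). Smoothness of `u` at `z_j = 0` says that the solution has a limit and its
derivative tends to zero at `-∞`. Abel's formula for the Wronskian shows that such solutions form at
most a line (`proportional_of_radial_equation`). The one-variable Poisson kernel is a solution of
the same kind, so changing the radii changes the `k`-th coefficient of `u` exactly as it changes the
product of the kernel coefficients (`coeff_mul_prod`).

The behaviour at the boundary supplies the constant. The kernel coefficients are hypergeometric
series multiplied by a power of `1 - t²`; Euler's limit for `Γ` and an Abelian argument show that
the Gamma quotient in the kernel normalizes their radial limits to `1`
(`tendsto_radialCoeff_discKernel`). For `p > 1`, the `L^p` bound makes the dilates converge along an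
ultrafilter, tested against continuous functions, to some `ψ` in `L^p`
(`exists_tendsto_integral_mul_continuous`). This limit is built by Radon–Nikodym from setwise limits
of integrals.

Letting one set of radii tend to `1` in the proportionality relation gives the coefficients of `u`
as `ψ̂(k)` times the kernel coefficients. These are the coefficients of `P[ψ]`, since the Poisson
integral is a convolution (`coeff_poissonIntegralAB`). Continuity and Fourier uniqueness give `u =
P[ψ]`. The same radial limits recover `ψ̂` from `P[ψ]`, whence uniqueness of `ψ`. -/

section FourierCoefficients

open Filter Topology Set

/-! ### Fourier coefficients on polydisc radii -/

/-- The point `(r₁ ζ₁, …, r_n ζ_n)`. -/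
def polar {n : ℕ} (r : Fin n → ℝ) (ζ : Torus n) : Fin n → ℂ := fun j => (r j : ℂ) * (ζ j : ℂ)

/-- The character `ζ ↦ ζ^k` of the torus. -/
noncomputable def chi {n : ℕ} (k : Fin n → ℤ) (ζ : Torus n) : ℂ := ∏ j, (ζ j : ℂ) ^ k j

/-- The `k`-th Fourier coefficient of `ζ ↦ w (r₁ ζ₁, …, r_n ζ_n)`. -/
noncomputable def coeff {n : ℕ} (w : (Fin n → ℂ) → ℂ) (k : Fin n → ℤ) (r : Fin n → ℝ) : ℂ :=
  ∫ ζ, w (polar r ζ) * chi (-k) ζ ∂(torusHaar n)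

/-- The vectors of radii of absolute value less than one. -/
def unitBox (n : ℕ) : Set (Fin n → ℝ) := {r | ∀ j, |r j| < 1}

/-- The radial derivative `r_j ∂/∂r_j` in the `j`-th variable. -/
noncomputable def radialDeriv {n : ℕ} (j : Fin n) (w : (Fin n → ℂ) → ℂ) (z : Fin n → ℂ) : ℂ :=
  fderiv ℝ w z (Pi.single j (z j))

/-- The angular derivative `∂/∂θ_j` in the `j`-th variable. -/
noncomputable def angularDeriv {n : ℕ} (j : Fin n) (w : (Fin n → ℂ) → ℂ) (z : Fin n → ℂ) : ℂ :=
  fderiv ℝ w z (Pi.single j (Complex.I * z j))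

variable {n : ℕ}

theorem isOpen_polydisc : IsOpen (polydisc n) := by
  simp only [polydisc, ofPred_forall]
  exact isOpen_iInter_of_finite fun j => isOpen_lt (by fun_prop) continuous_const

theorem isOpen_unitBox : IsOpen (unitBox n) := by
  simp only [unitBox, ofPred_forall]
  exact isOpen_iInter_of_finite fun j => isOpen_lt (by fun_prop) continuous_const

theorem polar_mem {r : Fin n → ℝ} (hr : r ∈ unitBox n) (ζ : Torus n) :
    polar r ζ ∈ polydisc n := by
  intro j
  simpa [polar, Circle.norm_coe (ζ j)] using hr j

theorem continuous_polar : Continuous (fun x : (Fin n → ℝ) × Torus n => polar x.1 x.2) := by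
  unfold polar
  fun_prop

theorem coe_ne_zero (ζ : Circle) : (ζ : ℂ) ≠ 0 := Circle.coe_ne_zero ζ

theorem continuous_chi (k : Fin n → ℤ) : Continuous (chi k) := by
  unfold chi
  refine continuous_finsetProd _ fun j _ => ?_
  refine Continuous.zpow₀ (by fun_prop) _ fun ζ => Or.inl (coe_ne_zero _)

theorem chi_mul (k : Fin n → ℤ) (ζ η : Torus n) : chi k (ζ * η) = chi k ζ * chi k η := by
  simp [chi, mul_zpow, Finset.prod_mul_distrib]

theorem chi_neg_mul_chi (k : Fin n → ℤ) (ζ : Torus n) : chi (-k) ζ * chi k ζ = 1 := by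
  rw [chi, chi, ← Finset.prod_mul_distrib]
  refine Finset.prod_eq_one fun j _ => ?_
  rw [Pi.neg_apply, ← zpow_add₀ (coe_ne_zero _)]
  simp

theorem chi_add (k l : Fin n → ℤ) (ζ : Torus n) : chi (k + l) ζ = chi k ζ * chi l ζ := by
  rw [chi, chi, chi, ← Finset.prod_mul_distrib]
  exact Finset.prod_congr rfl fun j _ => zpow_add₀ (coe_ne_zero _) _ _

theorem norm_chi (k : Fin n → ℤ) (ζ : Torus n) : ‖chi k ζ‖ = 1 := by
  rw [chi, norm_prod]
  refine Finset.prod_eq_one fun j _ => ?_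
  rw [norm_zpow, Circle.norm_coe (ζ j), one_zpow]

theorem conj_chi (k : Fin n → ℤ) (ζ : Torus n) : conj (chi k ζ) = chi (-k) ζ := by
  have h := chi_neg_mul_chi k ζ
  have h2 : conj (chi k ζ) * chi k ζ = 1 := by
    rw [mul_comm, Complex.mul_conj, Complex.normSq_eq_norm_sq, norm_chi]; simp
  have h3 : chi k ζ ≠ 0 := by
    rw [← norm_ne_zero_iff, norm_chi]; exact one_ne_zero
  exact mul_right_cancel₀ h3 (h2.trans h.symm)

theorem integrable_of_continuous {K : Type*} [TopologicalSpace K] [CompactSpace K]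
    [MeasurableSpace K] [BorelSpace K] {μ : Measure K} [IsFiniteMeasure μ] {f : K → ℂ}
    (hf : Continuous f) : Integrable f μ :=
  hf.integrable_of_hasCompactSupport (HasCompactSupport.of_compactSpace f)

/-- Joint continuity bounds the derivative by a constant on a closed ball times `K`, and a constant
is an integrable majorant for a finite measure. -/
theorem hasDerivAt_integral_of_compactSpace {K : Type*} [TopologicalSpace K] [CompactSpace K]
    [MeasurableSpace K] [BorelSpace K] {μ : Measure K} [IsFiniteMeasure μ]
    {Ψ Ψ' : ℝ → K → ℂ} {s : Set ℝ} (hs : IsOpen s) {t₀ : ℝ} (ht : t₀ ∈ s)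
    (hΨ : ContinuousOn (Function.uncurry Ψ) (s ×ˢ univ))
    (hΨ' : ContinuousOn (Function.uncurry Ψ') (s ×ˢ univ))
    (hd : ∀ t ∈ s, ∀ x, HasDerivAt (fun t => Ψ t x) (Ψ' t x) t) :
    HasDerivAt (fun t => ∫ x, Ψ t x ∂μ) (∫ x, Ψ' t₀ x ∂μ) t₀ := by
  obtain ⟨ε, hε, hball⟩ := Metric.nhds_basis_closedBall.mem_iff.1 (hs.mem_nhds ht)
  have hc : ∀ {F : ℝ → K → ℂ}, ContinuousOn (Function.uncurry F) (s ×ˢ univ) →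
      ∀ t ∈ s, Continuous (F t) := fun hF t hts =>
    hF.comp_continuous (f := fun x : K => (t, x)) (by fun_prop) fun x => ⟨hts, mem_univ _⟩
  obtain ⟨C, hC⟩ := ((isCompact_closedBall t₀ ε).prod
    (isCompact_univ (X := K))).exists_bound_of_continuousOn (hΨ'.mono (prod_mono hball subset_rfl))
  refine (hasDerivAt_integral_of_dominated_loc_of_deriv_le (μ := μ) (F := Ψ) (F' := Ψ')
    (bound := fun _ => C) (Metric.closedBall_mem_nhds t₀ hε) ?_ ?_ ?_ ?_ ?_ ?_).2
  · filter_upwards [hs.mem_nhds ht] with t hts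
    exact (hc hΨ t hts).aestronglyMeasurable
  · exact integrable_of_continuous (hc hΨ t₀ ht)
  · exact (hc hΨ' t₀ ht).aestronglyMeasurable
  · exact .of_forall fun x t htb => hC (t, x) ⟨htb, mem_univ _⟩
  · exact integrable_const _
  · exact .of_forall fun x t htb => hd t (hball htb) x

theorem continuousOn_coeff_integrand {w : (Fin n → ℂ) → ℂ} (hw : ContinuousOn w (polydisc n))
    (k : Fin n → ℤ) : ContinuousOn
      (fun x : (Fin n → ℝ) × Torus n => w (polar x.1 x.2) * chi k x.2) (unitBox n ×ˢ univ) := by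
  refine ContinuousOn.mul (hw.comp continuous_polar.continuousOn fun x hx => polar_mem hx.1 _) ?_
  exact ((continuous_chi k).comp continuous_snd).continuousOn

theorem continuousOn_coeff {w : (Fin n → ℂ) → ℂ} (hw : ContinuousOn w (polydisc n))
    (k : Fin n → ℤ) : ContinuousOn (coeff w k) (unitBox n) := by
  have := continuousOn_integral_of_compact_support (μ := torusHaar n) (k := univ) (s := unitBox n)
    (f := fun r ζ => w (polar r ζ) * chi (-k) ζ) isCompact_univ
    (continuousOn_coeff_integrand hw (-k)) (by simp)
  exact this

theorem continuous_polar_comp {w : (Fin n → ℂ) → ℂ} (hw : ContinuousOn w (polydisc n))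
    {r : Fin n → ℝ} (hr : r ∈ unitBox n) : Continuous fun ζ : Torus n => w (polar r ζ) := 
  hw.comp_continuous (continuous_polar.comp (by fun_prop : Continuous fun ζ : Torus n => (r, ζ)))
    fun ζ => polar_mem hr ζ


theorem continuousOn_fderiv_apply {w : (Fin n → ℂ) → ℂ} (hw : ContDiffOn ℝ 1 w (polydisc n))
    {e : (Fin n → ℂ) → Fin n → ℂ} (he : Continuous e) :
    ContinuousOn (fun z => fderiv ℝ w z (e z)) (polydisc n) :=
  (hw.continuousOn_fderiv_of_isOpen isOpen_polydisc le_rfl).clm_apply he.continuousOn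

theorem continuous_single_comp (j : Fin n) {e : (Fin n → ℂ) → ℂ} (he : Continuous e) :
    Continuous fun z => (Pi.single j (e z) : Fin n → ℂ) :=
  (continuous_single j).comp he

theorem continuousOn_radialDeriv {w : (Fin n → ℂ) → ℂ} (hw : ContDiffOn ℝ 1 w (polydisc n))
    (j : Fin n) : ContinuousOn (radialDeriv j w) (polydisc n) :=
  continuousOn_fderiv_apply hw (continuous_single_comp j (continuous_apply j))

theorem continuousOn_angularDeriv {w : (Fin n → ℂ) → ℂ} (hw : ContDiffOn ℝ 1 w (polydisc n))
    (j : Fin n) : ContinuousOn (angularDeriv j w) (polydisc n) :=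
  continuousOn_fderiv_apply hw (continuous_single_comp j (by fun_prop))

theorem differentiableAt_of_mem {w : (Fin n → ℂ) → ℂ} (hw : ContDiffOn ℝ 1 w (polydisc n))
    {z : Fin n → ℂ} (hz : z ∈ polydisc n) : DifferentiableAt ℝ w z :=
  (hw.contDiffAt (isOpen_polydisc.mem_nhds hz)).differentiableAt one_ne_zero

theorem update_mem_unitBox {r : Fin n → ℝ} (hr : r ∈ unitBox n) (j : Fin n) {t : ℝ}
    (ht : |t| < 1) : Function.update r j t ∈ unitBox n := by
  intro i
  rcases eq_or_ne i j with rfl | h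
  · simpa using ht
  · simpa [h] using hr i

theorem abs_exp_lt_one {s : ℝ} (hs : s < 0) : |Real.exp s| < 1 := by
  rw [abs_of_pos (Real.exp_pos s)]
  simpa using hs

theorem hasDerivAt_polar_update (r : Fin n → ℝ) (j : Fin n) (ζ : Torus n) (t : ℝ) :
    HasDerivAt (fun t => polar (Function.update r j (Real.exp t)) ζ)
      (Pi.single j (polar (Function.update r j (Real.exp t)) ζ j)) t := by
  rw [hasDerivAt_pi]
  intro i
  rcases eq_or_ne i j with rfl | h
  · simpa [polar] using ((Real.hasDerivAt_exp t).ofReal_comp.mul_const (ζ i : ℂ))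
  · simpa [polar, h] using hasDerivAt_const t ((r i : ℂ) * (ζ i : ℂ))

/-- In the variable `s = log r_j` the operator `r_j ∂/∂r_j` is plain `d/ds`, and the singular point
`r_j = 0` of the radial equation moves to `-∞`. -/
theorem hasDerivAt_coeff {w : (Fin n → ℂ) → ℂ} (hw : ContDiffOn ℝ 1 w (polydisc n))
    (k : Fin n → ℤ) {r : Fin n → ℝ} (hr : r ∈ unitBox n) (j : Fin n) {s : ℝ} (hs : s < 0) :
    HasDerivAt (fun s => coeff w k (Function.update r j (Real.exp s)))
      (coeff (radialDeriv j w) k (Function.update r j (Real.exp s))) s := by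
  let e : ℝ × Torus n → (Fin n → ℝ) × Torus n :=
    fun x => (Function.update r j (Real.exp x.1), x.2)
  have hmap : ContinuousOn e (Iio 0 ×ˢ univ) :=
    (Continuous.prodMk (continuous_const.update j (Real.continuous_exp.comp continuous_fst))
      continuous_snd).continuousOn
  have hmaps : MapsTo e (Iio 0 ×ˢ univ) (unitBox n ×ˢ univ) := fun x hx =>
    ⟨update_mem_unitBox hr j (abs_exp_lt_one hx.1), mem_univ _⟩
  have h1 := (continuousOn_coeff_integrand hw.continuousOn (-k)).comp hmap hmaps
  have h2 := (continuousOn_coeff_integrand (continuousOn_radialDeriv hw j) (-k)).comp hmap hmaps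
  have h3 : ∀ t ∈ Iio (0 : ℝ), ∀ ζ : Torus n, HasDerivAt
      (fun t => w (polar (Function.update r j (Real.exp t)) ζ) * chi (-k) ζ)
      (radialDeriv j w (polar (Function.update r j (Real.exp t)) ζ) * chi (-k) ζ) t := by
    intro t ht ζ
    have hD := (differentiableAt_of_mem hw (polar_mem (update_mem_unitBox hr j
      (abs_exp_lt_one ht)) ζ)).hasFDerivAt
    exact (hD.comp_hasDerivAt t (hasDerivAt_polar_update r j ζ t)).mul_const _
  exact hasDerivAt_integral_of_compactSpace
    (Ψ := fun s ζ => w (polar (Function.update r j (Real.exp s)) ζ) * chi (-k) ζ)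
    (Ψ' := fun s ζ => radialDeriv j w (polar (Function.update r j (Real.exp s)) ζ) * chi (-k) ζ)
    isOpen_Iio hs h1 h2 h3

/-- Invariance of Haar measure under translation. It serves both to differentiate in the angles and
to compute coefficients of convolutions. -/
theorem integral_mul_chi_mul (f : Torus n → ℂ) (k : Fin n → ℤ) (η : Torus n) :
    ∫ ζ, f (ζ * η) * chi (-k) ζ ∂(torusHaar n)
      = chi k η * ∫ ζ, f ζ * chi (-k) ζ ∂(torusHaar n) := by
  rw [← integral_mul_right_eq_self (fun ζ => f ζ * chi (-k) ζ) η, ← integral_const_mul]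
  congr 1
  funext ζ
  rw [chi_mul]
  linear_combination (-(f (ζ * η) * chi (-k) ζ)) * chi_neg_mul_chi k η

theorem chi_mulSingle (k : Fin n → ℤ) (j : Fin n) (η : Circle) :
    chi k (Pi.mulSingle j η) = (η : ℂ) ^ k j := by
  rw [chi, Finset.prod_eq_single j]
  · simp
  · intro i _ h
    simp [h]
  · simp

/-- In place of integration by parts, the `j`-th variable is rotated by `t` and the coefficient is
differentiated at `t = 0` in two ways: under the integral sign, and through the factor `e^{i k_j t}`
that the rotation produces. -/
theorem coeff_angularDeriv {w : (Fin n → ℂ) → ℂ} (hw : ContDiffOn ℝ 1 w (polydisc n))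
    (k : Fin n → ℤ) {r : Fin n → ℝ} (hr : r ∈ unitBox n) (j : Fin n) :
    coeff (angularDeriv j w) k r = Complex.I * k j * coeff w k r := by
  let rot : ℝ → Torus n := fun t => Pi.mulSingle j (Circle.exp t)
  have hrot : Continuous rot := (continuous_mulSingle j).comp (Circle.exp).continuous
  have hmap : ContinuousOn (fun x : ℝ × Torus n => (r, x.2 * rot x.1)) (univ ×ˢ univ) :=
    (by fun_prop : Continuous _).continuousOn
  have hmaps : MapsTo (fun x : ℝ × Torus n => (r, x.2 * rot x.1)) (univ ×ˢ univ)
      (unitBox n ×ˢ univ) := fun x _ => ⟨hr, mem_univ _⟩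
  have hchi : ContinuousOn (fun x : ℝ × Torus n => chi (-k) x.2 * chi k (x.2 * rot x.1))
      (univ ×ˢ univ) :=
    (((continuous_chi _).comp continuous_snd).mul
      ((continuous_chi _).comp (by fun_prop))).continuousOn
  have key : ∀ {v : (Fin n → ℂ) → ℂ}, ContinuousOn v (polydisc n) →
      ContinuousOn (fun x : ℝ × Torus n => v (polar r (x.2 * rot x.1)) * chi (-k) x.2)
        (univ ×ˢ univ) := by
    intro v hv
    -- The available continuity statement has the character at the rotated point; the factor `chi
    -- (-k) * chi k = 1` is inserted there.
    refine (((continuousOn_coeff_integrand hv (-k)).comp hmap hmaps).mul hchi).congr fun x _ => ?_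
    show _ = v (polar r (x.2 * rot x.1)) * chi (-k) (x.2 * rot x.1) *
      (chi (-k) x.2 * chi k (x.2 * rot x.1))
    linear_combination (-(v (polar r (x.2 * rot x.1)) * chi (-k) x.2)) *
      chi_neg_mul_chi k (x.2 * rot x.1)
  have h1 := hasDerivAt_integral_of_compactSpace (μ := torusHaar n) (t₀ := 0)
    (Ψ := fun t ζ => w (polar r (ζ * rot t)) * chi (-k) ζ)
    (Ψ' := fun t ζ => angularDeriv j w (polar r (ζ * rot t)) * chi (-k) ζ)
    isOpen_univ (mem_univ _) (key hw.continuousOn) (key (continuousOn_angularDeriv hw j)) (by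
      intro t _ ζ
      refine HasDerivAt.mul_const ?_ _
      have hp : HasDerivAt (fun t => polar r (ζ * rot t))
          (Pi.single j (Complex.I * polar r (ζ * rot t) j)) t := by
        rw [hasDerivAt_pi]
        intro i
        rcases eq_or_ne i j with rfl | h
        · have h0 : HasDerivAt (fun t : ℝ => (t : ℂ) * Complex.I) (1 * Complex.I) t :=
            (Complex.ofRealCLM.hasDerivAt (x := t)).mul_const _
          have := (h0.cexp.const_mul ((r i : ℂ) * (ζ i : ℂ)))
          simp only [polar, rot, Pi.mul_apply, Pi.mulSingle_eq_same, Pi.single_eq_same,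
            Circle.coe_mul, Circle.coe_exp]
          exact (this.congr_deriv (by ring)).congr_of_eventuallyEq
            (.of_forall fun t => by ring)
        · simpa [polar, rot, h] using hasDerivAt_const t _
      exact (differentiableAt_of_mem hw (polar_mem hr _)).hasFDerivAt.comp_hasDerivAt t hp)
  simp only [integral_mul_chi_mul (fun ζ => w (polar r ζ)),
    integral_mul_chi_mul (fun ζ => angularDeriv j w (polar r ζ)), rot, chi_mulSingle,
    Circle.exp_zero, Circle.coe_one, one_zpow, one_mul, Circle.coe_exp] at h1
  have h2 : HasDerivAt (fun t : ℝ => Complex.exp ((t : ℂ) * Complex.I) ^ k j * coeff w k r)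
      (Complex.I * k j * coeff w k r) 0 := by
    refine HasDerivAt.mul_const ?_ _
    have h0 : HasDerivAt (fun t : ℝ => (k j : ℂ) * ((t : ℂ) * Complex.I))
        ((k j : ℂ) * (1 * Complex.I)) 0 :=
      ((Complex.ofRealCLM.hasDerivAt (x := 0)).mul_const _).const_mul _
    refine (h0.cexp.congr_deriv ?_).congr_of_eventuallyEq
      (.of_forall fun t => (Complex.exp_int_mul _ _).symm)
    simp [mul_comm]
  exact h1.unique h2

end FourierCoefficients

section PolarEquation

open Filter Topology Set

/-! ### The equation in polar coordinates -/

variable {n : ℕ}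

theorem fderiv_fderiv_apply {u : (Fin n → ℂ) → ℂ} {z : Fin n → ℂ} (hu : ContDiffAt ℝ 2 u z)
    (L : (Fin n → ℂ) →L[ℝ] (Fin n → ℂ)) (c h : Fin n → ℂ) :
    fderiv ℝ (fun y => fderiv ℝ u y (L y + c)) z h
      = fderiv ℝ (fderiv ℝ u) z h (L z + c) + fderiv ℝ u z (L h) := by
  have h1 : HasFDerivAt (fderiv ℝ u) (fderiv ℝ (fderiv ℝ u) z) z :=
    ((hu.fderiv_right (m := 1) (by norm_num)).differentiableAt one_ne_zero).hasFDerivAt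
  have h2 : HasFDerivAt (fun y => L y + c) L z := L.hasFDerivAt.add_const c
  rw [(h1.clm_apply h2).fderiv]
  simp [add_comm]

theorem single_eq_re_im (j : Fin n) (w : ℂ) :
    (Pi.single j w : Fin n → ℂ)
      = w.re • (Pi.single j 1 : Fin n → ℂ) + w.im • (Pi.single j Complex.I : Fin n → ℂ) := by
  rw [← Pi.single_smul, ← Pi.single_smul, ← Pi.single_add]
  congr 1
  apply Complex.ext <;> simp

/-- The mixed terms cancel by symmetry of the second derivative, leaving a quarter of the Laplacian
in `z_j`. -/
theorem dz_dzbar {u : (Fin n → ℂ) → ℂ} {z : Fin n → ℂ} (hu : ContDiffAt ℝ 2 u z) (j : Fin n) :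
    dz j (dzbar j u) z = (1 / 4 : ℂ) *
      (fderiv ℝ (fderiv ℝ u) z (Pi.single j 1) (Pi.single j 1)
        + fderiv ℝ (fderiv ℝ u) z (Pi.single j Complex.I) (Pi.single j Complex.I)) := by
  have hsymm := (hu.isSymmSndFDerivAt (by simp)).eq (Pi.single j (1 : ℂ))
    (Pi.single j Complex.I)
  have h1 : DifferentiableAt ℝ (fderiv ℝ u) z :=
    (hu.fderiv_right (m := 1) (by norm_num)).differentiableAt one_ne_zero
  have h2 : ∀ c : Fin n → ℂ, HasFDerivAt (fun y => fderiv ℝ u y c)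
      ((fderiv ℝ (fderiv ℝ u) z).flip c) z := fun c => by
    simpa using h1.hasFDerivAt.clm_apply (hasFDerivAt_const c z)
  have h3 : HasFDerivAt (dzbar j u) _ z :=
    ((h2 (Pi.single j 1)).add ((h2 (Pi.single j Complex.I)).const_mul Complex.I)).const_mul
      (1 / 2 : ℂ)
  rw [dz, h3.fderiv]
  simp only [smul_apply, add_apply,
    ContinuousLinearMap.flip_apply, smul_eq_mul, hsymm]
  linear_combination (-(1 / 4 : ℂ) * fderiv ℝ (fderiv ℝ u) z (Pi.single j Complex.I)
    (Pi.single j Complex.I)) * Complex.I_sq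

theorem radialDeriv_eq (u : (Fin n → ℂ) → ℂ) (z : Fin n → ℂ) (j : Fin n) :
    radialDeriv j u z = (z j).re * fderiv ℝ u z (Pi.single j 1)
      + (z j).im * fderiv ℝ u z (Pi.single j Complex.I) := by
  rw [radialDeriv, single_eq_re_im]
  simp

theorem angularDeriv_eq (u : (Fin n → ℂ) → ℂ) (z : Fin n → ℂ) (j : Fin n) :
    angularDeriv j u z = -(z j).im * fderiv ℝ u z (Pi.single j 1)
      + (z j).re * fderiv ℝ u z (Pi.single j Complex.I) := by
  rw [angularDeriv, single_eq_re_im]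
  simp

theorem radialDeriv_add_angularDeriv {u : (Fin n → ℂ) → ℂ} {z : Fin n → ℂ}
    (hu : ContDiffAt ℝ 2 u z) (j : Fin n) :
    radialDeriv j (radialDeriv j u) z + angularDeriv j (angularDeriv j u) z
      = 4 * (‖z j‖ : ℂ) ^ 2 * dz j (dzbar j u) z := by
  have hR := fderiv_fderiv_apply hu
    ((ContinuousLinearMap.single ℝ (fun _ : Fin n => ℂ) j).comp
      (ContinuousLinearMap.proj (φ := fun _ : Fin n => ℂ) j)) 0 (Pi.single j (z j))
  have hA := fderiv_fderiv_apply hu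
    ((ContinuousLinearMap.single ℝ (fun _ : Fin n => ℂ) j).comp
      (Complex.I • (ContinuousLinearMap.proj (φ := fun _ : Fin n => ℂ) j)))
      0 (Pi.single j (Complex.I * z j))
  -- The first-order terms of the two iterated derivatives are `Du(z_j)` and `Du(i · i z_j) =
  -- -Du(z_j)`, and so they cancel.
  have hIz : Complex.I * (Complex.I * z j) = - z j := by
    linear_combination z j * Complex.I_sq
  simp only [add_zero, ContinuousLinearMap.comp_apply, smul_apply,
    ContinuousLinearMap.proj_apply, ContinuousLinearMap.single_apply, Pi.single_eq_same,
    smul_eq_mul, hIz] at hR hA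
  have hR' : radialDeriv j (radialDeriv j u) z = _ := hR
  have hA' : angularDeriv j (angularDeriv j u) z = _ := hA
  have hsymm := (hu.isSymmSndFDerivAt (by simp)).eq (Pi.single j (1 : ℂ))
    (Pi.single j Complex.I)
  have hnorm : (‖z j‖ : ℂ) ^ 2 = (z j).re ^ 2 + (z j).im ^ 2 := by
    rw [← Complex.ofReal_pow, Complex.sq_norm, Complex.normSq_apply]
    push_cast
    ring
  rw [hR', hA', dz_dzbar hu, hnorm, single_eq_re_im j (z j), single_eq_re_im j (Complex.I * z j),
    single_eq_re_im j (-z j)]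
  simp only [map_add, map_smul, add_apply, smul_apply,
    Complex.real_smul, Complex.mul_re, Complex.mul_im, Complex.I_re, Complex.I_im, Complex.neg_re,
    Complex.neg_im, hsymm]
  push_cast
  ring

/-- With `R` and `Θ` the radial and angular derivatives, `z ∂ = (R - iΘ)/2` and `z̄ ∂̄ = (R +
iΘ)/2`; the factor `|z_j|²` clears the denominator in the polar Laplacian. -/
theorem normSq_mul_opL {u : (Fin n → ℂ) → ℂ} {z : Fin n → ℂ} (hu : ContDiffAt ℝ 2 u z)
    (j : Fin n) (a b : ℂ) :
    (‖z j‖ : ℂ) ^ 2 * opL j a b u z =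
      (1 - (‖z j‖ : ℂ) ^ 2) / 4 *
        (radialDeriv j (radialDeriv j u) z + angularDeriv j (angularDeriv j u) z)
      + (‖z j‖ : ℂ) ^ 2 * ((a + b) / 2 * radialDeriv j u z
        + Complex.I * (b - a) / 2 * angularDeriv j u z - a * b * u z) := by
  have hz : z j = (z j).re + (z j).im * Complex.I := (Complex.re_add_im _).symm
  have hzc : conj (z j) = (z j).re - (z j).im * Complex.I := by
    apply Complex.ext <;> simp
  have h1 : z j * dz j u z = (radialDeriv j u z - Complex.I * angularDeriv j u z) / 2 := by
    rw [radialDeriv_eq, angularDeriv_eq, dz]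
    nth_rw 1 [hz]
    linear_combination (-(1 / 2 : ℂ) * (z j).im * fderiv ℝ u z (Pi.single j Complex.I))
      * Complex.I_sq
  have h2 : conj (z j) * dzbar j u z
      = (radialDeriv j u z + Complex.I * angularDeriv j u z) / 2 := by
    rw [radialDeriv_eq, angularDeriv_eq, dzbar, hzc]
    linear_combination (-(1 / 2 : ℂ) * (z j).im * fderiv ℝ u z (Pi.single j Complex.I))
      * Complex.I_sq
  rw [radialDeriv_add_angularDeriv hu, opL]
  linear_combination ((‖z j‖ : ℂ) ^ 2 * a) * h1 + ((‖z j‖ : ℂ) ^ 2 * b) * h2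

theorem contDiffOn_fderiv_clm {u : (Fin n → ℂ) → ℂ} (hu : ContDiffOn ℝ 2 u (polydisc n))
    (L : (Fin n → ℂ) →L[ℝ] (Fin n → ℂ)) :
    ContDiffOn ℝ 1 (fun z => fderiv ℝ u z (L z)) (polydisc n) :=
  (hu.fderiv_of_isOpen isOpen_polydisc (by norm_num)).clm_apply L.contDiff.contDiffOn

theorem contDiffOn_radialDeriv {u : (Fin n → ℂ) → ℂ} (hu : ContDiffOn ℝ 2 u (polydisc n))
    (j : Fin n) : ContDiffOn ℝ 1 (radialDeriv j u) (polydisc n) :=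
  contDiffOn_fderiv_clm hu ((ContinuousLinearMap.single ℝ (fun _ : Fin n => ℂ) j).comp
      (ContinuousLinearMap.proj (φ := fun _ : Fin n => ℂ) j))

theorem contDiffOn_angularDeriv {u : (Fin n → ℂ) → ℂ} (hu : ContDiffOn ℝ 2 u (polydisc n))
    (j : Fin n) : ContDiffOn ℝ 1 (angularDeriv j u) (polydisc n) :=
  (contDiffOn_fderiv_clm hu ((ContinuousLinearMap.single ℝ (fun _ : Fin n => ℂ) j).comp
      (Complex.I • (ContinuousLinearMap.proj (φ := fun _ : Fin n => ℂ) j)))).congr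
    fun z _ => by simp [angularDeriv]

theorem integrable_coeff_integrand {w : (Fin n → ℂ) → ℂ} (hw : ContinuousOn w (polydisc n))
    (k : Fin n → ℤ) {r : Fin n → ℝ} (hr : r ∈ unitBox n) :
    Integrable (fun ζ => w (polar r ζ) * chi (-k) ζ) (torusHaar n) :=
  integrable_of_continuous ((continuous_polar_comp hw hr).mul (continuous_chi _))

/-- On a torus of fixed radii the polar equation has constant coefficients, so it can be integrated
against the character, which turns `∂/∂θ_j` into `i k_j`. -/
theorem coeff_radial_equation {α β : Fin n → ℂ} {u : (Fin n → ℂ) → ℂ} (hu : IsSepHarmonic α β u)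
    (k : Fin n → ℤ) {r : Fin n → ℝ} (hr : r ∈ unitBox n) (j : Fin n) :
    (1 - (r j : ℂ) ^ 2) / 4 *
        (coeff (radialDeriv j (radialDeriv j u)) k r - (k j : ℂ) ^ 2 * coeff u k r)
      + (r j : ℂ) ^ 2 * ((α j + β j) / 2 * coeff (radialDeriv j u) k r
        + ((k j : ℂ) * (α j - β j) / 2 - α j * β j) * coeff u k r) = 0 := by
  have hu1 : ContDiffOn ℝ 1 u (polydisc n) := hu.1.of_le (by norm_num)
  have hR := contDiffOn_radialDeriv hu.1 j
  have hA := contDiffOn_angularDeriv hu.1 j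
  have iu := integrable_coeff_integrand hu1.continuousOn k hr
  have iR := integrable_coeff_integrand hR.continuousOn k hr
  have iA := integrable_coeff_integrand hA.continuousOn k hr
  have iRR := integrable_coeff_integrand (continuousOn_radialDeriv hR j) k hr
  have iAA := integrable_coeff_integrand (continuousOn_angularDeriv hA j) k hr
  have eA := coeff_angularDeriv hu1 k hr j
  have eAA := coeff_angularDeriv hA k hr j
  have hnorm : ∀ ζ : Torus n, (‖polar r ζ j‖ : ℂ) ^ 2 = (r j : ℂ) ^ 2 := fun ζ => by
    rw [polar, norm_mul, Circle.norm_coe (ζ j), Complex.norm_real, mul_one, ← Complex.ofReal_pow,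
      Real.norm_eq_abs, sq_abs, Complex.ofReal_pow]
  have hpt : ∀ ζ : Torus n, (1 - (r j : ℂ) ^ 2) / 4 *
        (radialDeriv j (radialDeriv j u) (polar r ζ) * chi (-k) ζ
          + angularDeriv j (angularDeriv j u) (polar r ζ) * chi (-k) ζ)
      + (r j : ℂ) ^ 2 * ((α j + β j) / 2 * (radialDeriv j u (polar r ζ) * chi (-k) ζ)
        + Complex.I * (β j - α j) / 2 * (angularDeriv j u (polar r ζ) * chi (-k) ζ)
        - α j * β j * (u (polar r ζ) * chi (-k) ζ)) = 0 := fun ζ => by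
    have h := normSq_mul_opL (hu.1.contDiffAt (isOpen_polydisc.mem_nhds (polar_mem hr ζ))) j
      (α j) (β j)
    rw [hu.2 j _ (polar_mem hr ζ), hnorm] at h
    linear_combination (-chi (-k) ζ) * h
  have hint := integral_congr_ae (μ := torusHaar n) (Eventually.of_forall hpt)
  rw [integral_add (by fun_prop) (by fun_prop), integral_const_mul, integral_const_mul,
    integral_add iRR iAA, integral_sub (by fun_prop) (by fun_prop),
    integral_add (by fun_prop) (by fun_prop), integral_const_mul, integral_const_mul,
    integral_const_mul, integral_zero] at hint
  change _ * (coeff _ k r + coeff _ k r) + _ * (_ * coeff _ k r + _ * coeff _ k r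
    - _ * coeff _ k r) = 0 at hint
  rw [eAA, eA] at hint
  linear_combination hint + (-((1 - (r j : ℂ) ^ 2) / 4 * (k j : ℂ) ^ 2 * coeff u k r) -
    (r j : ℂ) ^ 2 * (k j * (β j - α j) / 2 * coeff u k r)) * Complex.I_sq

end PolarEquation

section SecondOrderEquation

open Filter Topology Set

/-! ### Linear equations of second order on a half-line -/

/-- Uniqueness for the first-order system satisfied by `(H, H₁)`, on a compact interval in the open
half-line around both points: there `p` and `q` are bounded and the system is Lipschitz. -/
theorem eq_zero_of_linear_second_order {p q H H₁ : ℝ → ℂ} (hp : ContinuousOn p (Iio 0))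
    (hq : ContinuousOn q (Iio 0)) (hH : ∀ s < 0, HasDerivAt H (H₁ s) s)
    (hH₁ : ∀ s < 0, HasDerivAt H₁ (q s * H₁ s + p s * H s) s) {s₀ : ℝ} (hs₀ : s₀ < 0)
    (h0 : H s₀ = 0) (h1 : H₁ s₀ = 0) {t : ℝ} (ht : t < 0) : H t = 0 := by
  obtain ⟨c, hc⟩ : ∃ c, c < min s₀ t := exists_lt _
  obtain ⟨d, hd, hd0⟩ : ∃ d, max s₀ t < d ∧ d < 0 := exists_between (max_lt hs₀ ht)
  have hsub : Icc c d ⊆ Iio 0 := fun x hx => hx.2.trans_lt hd0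
  obtain ⟨Cp, hCp⟩ := isCompact_Icc.exists_bound_of_continuousOn (hp.mono hsub)
  obtain ⟨Cq, hCq⟩ := isCompact_Icc.exists_bound_of_continuousOn (hq.mono hsub)
  let v : ℝ → ℂ × ℂ → ℂ × ℂ := fun s y => (y.2, q s * y.2 + p s * y.1)
  have hv : ∀ s ∈ Ioo c d, LipschitzOnWith (Real.toNNReal (1 + |Cq| + |Cp|)) (v s) univ := by
    intro s hs
    refine LipschitzOnWith.of_dist_le_mul fun x _ y _ => ?_
    rw [dist_eq_norm, dist_eq_norm, Real.coe_toNNReal _ (by positivity)]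
    have e : v s x - v s y = ((x - y).2, q s * (x - y).2 + p s * (x - y).1) := by
      ext1
      · rfl
      · simp only [v, Prod.snd_sub, Prod.fst_sub]; ring
    have n1 : ‖(x - y).1‖ ≤ ‖x - y‖ := norm_fst_le _
    have n2 : ‖(x - y).2‖ ≤ ‖x - y‖ := norm_snd_le _
    have hqs := (hCq s (Ioo_subset_Icc_self hs)).trans (le_abs_self Cq)
    have hps := (hCp s (Ioo_subset_Icc_self hs)).trans (le_abs_self Cp)
    have n0 := norm_nonneg (x - y)
    rw [e, Prod.norm_def]
    refine max_le ?_ ?_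
    · nlinarith [abs_nonneg Cq, abs_nonneg Cp]
    · calc ‖q s * (x - y).2 + p s * (x - y).1‖
          ≤ ‖q s‖ * ‖(x - y).2‖ + ‖p s‖ * ‖(x - y).1‖ := by
            refine (norm_add_le _ _).trans ?_
            rw [norm_mul, norm_mul]
        _ ≤ |Cq| * ‖x - y‖ + |Cp| * ‖x - y‖ := by gcongr
        _ ≤ _ := by nlinarith
  have hf : ∀ s ∈ Ioo c d, HasDerivAt (fun s => (H s, H₁ s)) (v s (H s, H₁ s)) s ∧
      (H s, H₁ s) ∈ (univ : Set (ℂ × ℂ)) := fun s hs =>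
    ⟨(hH s (hsub (Ioo_subset_Icc_self hs))).prodMk (hH₁ s (hsub (Ioo_subset_Icc_self hs))),
      mem_univ _⟩
  have hg : ∀ s ∈ Ioo c d, HasDerivAt (fun _ => (0 : ℂ × ℂ)) (v s 0) s ∧
      (0 : ℂ × ℂ) ∈ (univ : Set (ℂ × ℂ)) := fun s _ => by
    refine ⟨?_, mem_univ _⟩
    have e : v s 0 = 0 := by simp [v]
    rw [e]
    exact hasDerivAt_const s (0 : ℂ × ℂ)
  have huniq := ODE_solution_unique_of_mem_Ioo hv
    (t₀ := s₀) ⟨hc.trans_le (min_le_left _ _), (le_max_left _ _).trans_lt hd⟩ hf hg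
    (by simp [h0, h1])
  have := huniq (x := t) ⟨hc.trans_le (min_le_right _ _), (le_max_right _ _).trans_lt hd⟩
  exact congrArg Prod.fst this

/-- Two solutions of a linear equation of second order whose Wronskian vanishes at `-∞` are
proportional. -/
theorem proportional_of_linear_second_order {p q Q F F₁ G G₁ : ℝ → ℂ}
    (hp : ContinuousOn p (Iio 0)) (hq : ContinuousOn q (Iio 0))
    (hQ : ∀ s < 0, HasDerivAt Q (q s) s) {Q₀ : ℂ} (hQ₀ : Tendsto Q atBot (𝓝 Q₀))
    (hF : ∀ s < 0, HasDerivAt F (F₁ s) s)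
    (hF₁ : ∀ s < 0, HasDerivAt F₁ (q s * F₁ s + p s * F s) s)
    (hG : ∀ s < 0, HasDerivAt G (G₁ s) s)
    (hG₁ : ∀ s < 0, HasDerivAt G₁ (q s * G₁ s + p s * G s) s)
    {f₀ g₀ : ℂ} (hF0 : Tendsto F atBot (𝓝 f₀)) (hG0 : Tendsto G atBot (𝓝 g₀))
    (hF10 : Tendsto F₁ atBot (𝓝 0)) (hG10 : Tendsto G₁ atBot (𝓝 0))
    {s t : ℝ} (hs : s < 0) (ht : t < 0) : F s * G t = F t * G s := by
  -- Abel's formula: the Wronskian satisfies `W' = q W`, so `W e^{-Q}` is constant, and its limit at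
  -- `-∞` is zero.
  have hW : ∀ s < 0, HasDerivAt
      (fun s => (F s * G₁ s - F₁ s * G s) * Complex.exp (-Q s)) 0 s := fun s hs => by
    have h := (((hF s hs).mul (hG₁ s hs)).sub ((hF₁ s hs).mul (hG s hs))).mul
      ((hQ s hs).neg.cexp)
    refine h.congr_deriv ?_
    simp only [Pi.sub_apply, Pi.mul_apply]
    ring
  obtain ⟨c, hc⟩ := isOpen_Iio.exists_is_const_of_deriv_eq_zero (isPreconnected_Iio (a := (0 : ℝ)))
    (fun s hs => (hW s hs).differentiableAt.differentiableWithinAt) (fun s hs => (hW s hs).deriv)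
  have hlim : Tendsto (fun s => (F s * G₁ s - F₁ s * G s) * Complex.exp (-Q s)) atBot (𝓝 0) := by
    have := ((hF0.mul hG10).sub (hF10.mul hG0)).mul
      (Complex.continuous_exp.tendsto _ |>.comp hQ₀.neg)
    simpa using this
  have hc0 : c = 0 := by
    refine tendsto_nhds_unique (tendsto_const_nhds.congr' ?_) hlim
    filter_upwards [Iio_mem_atBot (0 : ℝ)] with s hs using (hc s hs).symm
  have hWs : F s * G₁ s - F₁ s * G s = 0 := by
    have := hc s hs
    rw [hc0] at this
    exact (mul_eq_zero.1 this).resolve_right (Complex.exp_ne_zero _)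
  -- This combination vanishes at `s` together with its derivative, the latter being minus the
  -- Wronskian at `s`.
  have hzero := eq_zero_of_linear_second_order (H := fun t => G s * F t - F s * G t)
    (H₁ := fun t => G s * F₁ t - F s * G₁ t) hp hq
    (fun t ht => ((hF t ht).const_mul _).sub ((hG t ht).const_mul _))
    (fun t ht => (((hF₁ t ht).const_mul _).sub ((hG₁ t ht).const_mul _)).congr_deriv (by ring))
    hs (by ring) (by linear_combination -hWs) ht
  linear_combination -hzero

/-- Regular solutions of the radial equation are proportional. -/
theorem proportional_of_radial_equation {γ c κ : ℂ} {F F₁ F₂ G G₁ G₂ : ℝ → ℂ}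
    (hF : ∀ s < 0, HasDerivAt F (F₁ s) s) (hF₁ : ∀ s < 0, HasDerivAt F₁ (F₂ s) s)
    (hFe : ∀ s < 0, (1 - (Real.exp s : ℂ) ^ 2) / 4 * (F₂ s - κ * F s)
      + (Real.exp s : ℂ) ^ 2 * (γ / 2 * F₁ s + c * F s) = 0)
    (hG : ∀ s < 0, HasDerivAt G (G₁ s) s) (hG₁ : ∀ s < 0, HasDerivAt G₁ (G₂ s) s)
    (hGe : ∀ s < 0, (1 - (Real.exp s : ℂ) ^ 2) / 4 * (G₂ s - κ * G s)
      + (Real.exp s : ℂ) ^ 2 * (γ / 2 * G₁ s + c * G s) = 0)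
    {f₀ g₀ : ℂ} (hF0 : Tendsto F atBot (𝓝 f₀)) (hG0 : Tendsto G atBot (𝓝 g₀))
    (hF10 : Tendsto F₁ atBot (𝓝 0)) (hG10 : Tendsto G₁ atBot (𝓝 0))
    {s t : ℝ} (hs : s < 0) (ht : t < 0) : F s * G t = F t * G s := by
  have hpos : ∀ s : ℝ, s < 0 → 0 < 1 - Real.exp s ^ 2 := fun s hs => by
    have := Real.exp_lt_one_iff.2 hs
    nlinarith [Real.exp_pos s]
  have hne : ∀ s : ℝ, s < 0 → (1 - (Real.exp s : ℂ) ^ 2) ≠ 0 := fun s hs => by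
    exact_mod_cast (hpos s hs).ne'
  have hcont : ContinuousOn (fun s : ℝ => (Real.exp s : ℂ) ^ 2 / (1 - (Real.exp s : ℂ) ^ 2))
      (Iio 0) := by
    refine ContinuousOn.div (Continuous.continuousOn (by fun_prop))
      (Continuous.continuousOn (by fun_prop)) hne
  -- `γ log (1 - e^{2s})` is a primitive of the coefficient of the first derivative once the
  -- equation is solved for the second.
  have hQ : ∀ s < 0, HasDerivAt (fun s : ℝ => γ * (Real.log (1 - Real.exp s ^ 2) : ℂ))
      (-2 * γ * ((Real.exp s : ℂ) ^ 2 / (1 - (Real.exp s : ℂ) ^ 2))) s := fun s hs => by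
    have h := ((((Real.hasDerivAt_exp s).pow 2).const_sub 1).log
      (hpos s hs).ne').ofReal_comp.const_mul γ
    refine h.congr_deriv ?_
    simp only [Pi.pow_apply]
    push_cast
    ring
  have hQ0 : Tendsto (fun s : ℝ => γ * (Real.log (1 - Real.exp s ^ 2) : ℂ)) atBot (𝓝 0) := by
    have h1 : Tendsto (fun s : ℝ => 1 - Real.exp s ^ 2) atBot (𝓝 1) := by
      simpa using (Real.tendsto_exp_atBot.pow 2).const_sub 1
    have h2 := ((Real.continuousAt_log one_ne_zero).tendsto.comp h1)
    have h3 := ((Complex.continuous_ofReal.tendsto _).comp h2).const_mul γ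
    simpa using h3
  have hsolve : ∀ {x x₁ x₂ : ℂ} (s : ℝ), s < 0 → (1 - (Real.exp s : ℂ) ^ 2) / 4 * (x₂ - κ * x)
      + (Real.exp s : ℂ) ^ 2 * (γ / 2 * x₁ + c * x) = 0 →
      x₂ = -2 * γ * ((Real.exp s : ℂ) ^ 2 / (1 - (Real.exp s : ℂ) ^ 2)) * x₁
        + (κ - 4 * c * ((Real.exp s : ℂ) ^ 2 / (1 - (Real.exp s : ℂ) ^ 2))) * x := by
    intro x x₁ x₂ s hs h
    have := hne s hs
    field_simp
    linear_combination 4 * h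
  exact proportional_of_linear_second_order
    (q := fun s => -2 * γ * ((Real.exp s : ℂ) ^ 2 / (1 - (Real.exp s : ℂ) ^ 2)))
    (p := fun s => κ - 4 * c * ((Real.exp s : ℂ) ^ 2 / (1 - (Real.exp s : ℂ) ^ 2)))
    (continuousOn_const.sub (continuousOn_const.mul hcont)) (continuousOn_const.mul hcont) hQ hQ0
    hF (fun s hs => hsolve s hs (hFe s hs) ▸ hF₁ s hs)
    hG (fun s hs => hsolve s hs (hGe s hs) ▸ hG₁ s hs) hF0 hG0 hF10 hG10 hs ht

end SecondOrderEquation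

section Separation

open Filter Topology Set

/-! ### Separation of the radial variables -/

variable {n : ℕ}

/-- The `k`-th Fourier coefficient of a function on the disc, as a function of the radius. -/
noncomputable def radialCoeff (v : (Fin 1 → ℂ) → ℂ) (k : ℤ) (t : ℝ) : ℂ :=
  coeff v (fun _ => k) (fun _ => t)

theorem const_mem_unitBox {t : ℝ} (ht : |t| < 1) : (fun _ => t) ∈ unitBox n := fun _ => ht

theorem continuousAt_coeff_update {w : (Fin n → ℂ) → ℂ} (hw : ContinuousOn w (polydisc n))
    (k : Fin n → ℤ) {r : Fin n → ℝ} (hr : r ∈ unitBox n) (j : Fin n) {t : ℝ} (ht : |t| < 1) :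
    ContinuousAt (fun t => coeff w k (Function.update r j t)) t := by
  have h := (continuousOn_coeff hw k).continuousAt
    (isOpen_unitBox.mem_nhds (update_mem_unitBox hr j ht))
  exact ContinuousAt.comp (f := fun t => Function.update r j t) h
    ((continuous_const.update j continuous_id).continuousAt)

theorem continuousAt_radialCoeff {v : (Fin 1 → ℂ) → ℂ} (hv : ContinuousOn v (polydisc 1))
    (k : ℤ) {t : ℝ} (ht : |t| < 1) : ContinuousAt (radialCoeff v k) t := by
  have h := (continuousOn_coeff hv fun _ => k).continuousAt
    (isOpen_unitBox.mem_nhds (const_mem_unitBox ht))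
  exact ContinuousAt.comp (f := fun t : ℝ => fun _ : Fin 1 => t) h (by fun_prop)

/-- The direction `z_j` of differentiation vanishes at `z_j = 0`. This is the regularity condition
at `-∞` that singles out one line of solutions. -/
theorem coeff_radialDeriv_update_zero (w : (Fin n → ℂ) → ℂ) (k : Fin n → ℤ) (r : Fin n → ℝ)
    (j : Fin n) : coeff (radialDeriv j w) k (Function.update r j 0) = 0 := by
  have : ∀ ζ : Torus n, radialDeriv j w (polar (Function.update r j 0) ζ) = 0 := fun ζ => by
    simp [radialDeriv, polar]
  simp [coeff, this]

theorem tendsto_coeff_update_exp {w : (Fin n → ℂ) → ℂ} (hw : ContinuousOn w (polydisc n))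
    (k : Fin n → ℤ) {r : Fin n → ℝ} (hr : r ∈ unitBox n) (j : Fin n) :
    Tendsto (fun s => coeff w k (Function.update r j (Real.exp s))) atBot
      (𝓝 (coeff w k (Function.update r j 0))) :=
  (continuousAt_coeff_update hw k hr j (t := 0) (by simp)).tendsto.comp Real.tendsto_exp_atBot

theorem update_eq_const (r : Fin 1 → ℝ) (t : ℝ) : Function.update r 0 t = fun _ => t := by
  funext i
  simp [Subsingleton.elim i 0]

/-- The other radii do not enter the equation in `r_j`, so `u` and the one-variable `v` yield
regular solutions of the same ODE. -/
theorem coeff_update_exp_mul {α β : Fin n → ℂ} {u : (Fin n → ℂ) → ℂ} (hu : IsSepHarmonic α β u)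
    (k : Fin n → ℤ) {r : Fin n → ℝ} (hr : r ∈ unitBox n) (j : Fin n) {v : (Fin 1 → ℂ) → ℂ}
    (hv : IsSepHarmonic (fun _ => α j) (fun _ => β j) v) {s t : ℝ} (hs : s < 0) (ht : t < 0) :
    coeff u k (Function.update r j (Real.exp s)) * radialCoeff v (k j) (Real.exp t)
      = coeff u k (Function.update r j (Real.exp t)) * radialCoeff v (k j) (Real.exp s) := by
  have hu1 : ContDiffOn ℝ 1 u (polydisc n) := hu.1.of_le (by norm_num)
  have hv1 : ContDiffOn ℝ 1 v (polydisc 1) := hv.1.of_le (by norm_num)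
  have hRu := contDiffOn_radialDeriv hu.1 j
  have hRv := contDiffOn_radialDeriv hv.1 0
  have h0 : (fun _ => 0 : Fin 1 → ℝ) ∈ unitBox 1 := const_mem_unitBox (by simp)
  have e : ∀ t, radialCoeff v (k j) t
      = coeff v (fun _ => k j) (Function.update (fun _ => 0) 0 t) := fun t => by
    rw [update_eq_const, radialCoeff]
  have l1 := tendsto_coeff_update_exp hRu.continuousOn k hr j
  have l2 := tendsto_coeff_update_exp hRv.continuousOn (fun _ => k j) h0 0
  rw [coeff_radialDeriv_update_zero] at l1 l2
  simp only [e]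
  refine proportional_of_radial_equation (κ := (k j : ℂ) ^ 2) (γ := α j + β j)
    (c := (k j : ℂ) * (α j - β j) / 2 - α j * β j)
    (F := fun s => coeff u k (Function.update r j (Real.exp s)))
    (G := fun s => coeff v (fun _ => k j) (Function.update (fun _ => 0) 0 (Real.exp s)))
    (fun s hs => hasDerivAt_coeff hu1 k hr j hs) (fun s hs => hasDerivAt_coeff hRu k hr j hs) ?_
    (fun s hs => hasDerivAt_coeff hv1 _ h0 0 hs) (fun s hs => hasDerivAt_coeff hRv _ h0 0 hs) ?_
    (tendsto_coeff_update_exp hu1.continuousOn k hr j)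
    (tendsto_coeff_update_exp hv1.continuousOn _ h0 0) l1 l2 hs ht
  · intro s hs
    simpa using coeff_radial_equation hu k (update_mem_unitBox hr j (abs_exp_lt_one hs)) j
  · intro s hs
    simpa using coeff_radial_equation hv (fun _ => k j)
      (update_mem_unitBox h0 0 (abs_exp_lt_one hs)) 0

/-- The logarithmic variable misses radius zero, which is restored by continuity. -/
theorem eq_at_zero_of_eq_pos {φ ψ : ℝ → ℂ} (hφ : ContinuousAt φ 0) (hψ : ContinuousAt ψ 0)
    (h : ∀ s ∈ Ioo (0 : ℝ) 1, φ s = ψ s) : φ 0 = ψ 0 := by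
  have h1 : Tendsto φ (𝓝[>] 0) (𝓝 (φ 0)) := hφ.tendsto.mono_left nhdsWithin_le_nhds
  have h2 : Tendsto ψ (𝓝[>] 0) (𝓝 (ψ 0)) := hψ.tendsto.mono_left nhdsWithin_le_nhds
  refine tendsto_nhds_unique (h1.congr' ?_) h2
  filter_upwards [Ioo_mem_nhdsGT one_pos] with s hs using h s hs

theorem coeff_update_mul {α β : Fin n → ℂ} {u : (Fin n → ℂ) → ℂ} (hu : IsSepHarmonic α β u)
    (k : Fin n → ℤ) {r : Fin n → ℝ} (hr : r ∈ unitBox n) (j : Fin n) {v : (Fin 1 → ℂ) → ℂ}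
    (hv : IsSepHarmonic (fun _ => α j) (fun _ => β j) v) {s t : ℝ} (hs : s ∈ Ico (0 : ℝ) 1)
    (ht : t ∈ Ico (0 : ℝ) 1) :
    coeff u k (Function.update r j s) * radialCoeff v (k j) t
      = coeff u k (Function.update r j t) * radialCoeff v (k j) s := by
  have hU : ∀ {t : ℝ}, |t| < 1 → ContinuousAt (fun t => coeff u k (Function.update r j t)) t :=
    fun ht => continuousAt_coeff_update hu.1.continuousOn k hr j ht
  have hV : ∀ {t : ℝ}, |t| < 1 → ContinuousAt (radialCoeff v (k j)) t :=
    fun ht => continuousAt_radialCoeff hv.1.continuousOn (k j) ht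
  have hz : |(0 : ℝ)| < 1 := by simp
  have hpos : ∀ s ∈ Ioo (0 : ℝ) 1, ∀ t ∈ Ioo (0 : ℝ) 1,
      coeff u k (Function.update r j s) * radialCoeff v (k j) t
      = coeff u k (Function.update r j t) * radialCoeff v (k j) s := by
    intro s hs t ht
    have := coeff_update_exp_mul hu k hr j hv (Real.log_neg hs.1 hs.2) (Real.log_neg ht.1 ht.2)
    rwa [Real.exp_log hs.1, Real.exp_log ht.1] at this
  have hright : ∀ s ∈ Ioo (0 : ℝ) 1, ∀ t ∈ Ico (0 : ℝ) 1,
      coeff u k (Function.update r j s) * radialCoeff v (k j) t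
      = coeff u k (Function.update r j t) * radialCoeff v (k j) s := by
    intro s hs t ht
    rcases ht.1.eq_or_lt with rfl | h
    · exact eq_at_zero_of_eq_pos (continuousAt_const.mul (hV hz)) ((hU hz).mul continuousAt_const)
        fun t ht => hpos s hs t ht
    · exact hpos s hs t ⟨h, ht.2⟩
  rcases hs.1.eq_or_lt with rfl | h
  · exact eq_at_zero_of_eq_pos ((hU hz).mul continuousAt_const) (continuousAt_const.mul (hV hz))
      fun s hs => hright s hs t ht
  · exact hright s ⟨h, hs.2⟩ t ht

/-- The radii are exchanged one coordinate at a time. The cross-multiplied form avoids dividing by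
kernel coefficients, which do vanish at radius zero when the frequency is nonzero. -/
theorem coeff_mul_prod {α β : Fin n → ℂ} {u : (Fin n → ℂ) → ℂ} (hu : IsSepHarmonic α β u)
    (k : Fin n → ℤ) {v : Fin n → (Fin 1 → ℂ) → ℂ}
    (hv : ∀ j, IsSepHarmonic (fun _ => α j) (fun _ => β j) (v j)) {r s : Fin n → ℝ}
    (hr : ∀ j, r j ∈ Ico (0 : ℝ) 1) (hs : ∀ j, s j ∈ Ico (0 : ℝ) 1) :
    coeff u k s * ∏ j, radialCoeff (v j) (k j) (r j)
      = coeff u k r * ∏ j, radialCoeff (v j) (k j) (s j) := by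
  have key : ∀ S : Finset (Fin n), coeff u k (S.piecewise s r)
      * ∏ j ∈ S, radialCoeff (v j) (k j) (r j)
      = coeff u k r * ∏ j ∈ S, radialCoeff (v j) (k j) (s j) := by
    intro S
    induction S using Finset.induction_on with
    | empty => simp
    | insert j S hj ih =>
      have hmem : S.piecewise s r ∈ unitBox n := fun i => by
        by_cases h : i ∈ S
        · simpa [h, abs_of_nonneg (hs i).1] using (hs i).2
        · simpa [h, abs_of_nonneg (hr i).1] using (hr i).2
      have h1 := coeff_update_mul hu k hmem j (hv j) (hs j) (hr j)
      have h2 : Function.update (S.piecewise s r) j (r j) = S.piecewise s r := by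
        rw [Function.update_eq_self_iff]
        simp [hj]
      rw [Finset.piecewise_insert, Finset.prod_insert hj, Finset.prod_insert hj]
      rw [h2] at h1
      linear_combination (∏ j ∈ S, radialCoeff (v j) (k j) (r j)) * h1
        + radialCoeff (v j) (k j) (s j) * ih
  simpa using key Finset.univ

end Separation

section DiscKernel

open Filter Topology Set

/-! ### The kernel of the disc -/

/-- The `(a, b)`-Poisson kernel of the disc with pole at `1`. -/
noncomputable def discKernel (a b w : ℂ) : ℂ :=
  poissonConst a b *
    ((1 - (‖w‖ : ℂ) ^ 2) ^ (a + b + 1) / ((1 - w) ^ (a + 1) * (1 - conj w) ^ (b + 1)))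

theorem poissonKernelAB_eq_prod {n : ℕ} (α β : Fin n → ℂ) (z : Fin n → ℂ) (ζ : Torus n) :
    poissonKernelAB α β z ζ = ∏ j, discKernel (α j) (β j) (z j * conj (ζ j : ℂ)) := by
  refine Finset.prod_congr rfl fun j _ => ?_
  rw [discKernel, norm_mul, Complex.norm_conj, Circle.norm_coe (ζ j), mul_one, map_mul,
    Complex.conj_conj]

/-- The real-linear map `h ↦ A h + B h̄`. -/
noncomputable def wirtinger (A B : ℂ) : ℂ →L[ℝ] ℂ :=
  A • (ContinuousLinearMap.id ℝ ℂ) + B • (Complex.conjCLE : ℂ →L[ℝ] ℂ)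

theorem wirtinger_apply (A B h : ℂ) : wirtinger A B h = A * h + B * conj h := by
  simp [wirtinger]

theorem hasFDerivAt_wirtinger_id (w : ℂ) : HasFDerivAt (fun w => w) (wirtinger 1 0) w := by
  refine (hasFDerivAt_id (𝕜 := ℝ) w).congr_fderiv ?_
  ext h
  simp [wirtinger_apply]

theorem hasFDerivAt_wirtinger_conj (w : ℂ) :
    HasFDerivAt (fun w => conj w) (wirtinger 0 1) w := by
  refine (Complex.conjCLE.hasFDerivAt (x := w)).congr_fderiv ?_
  ext h
  simp [wirtinger_apply]

/-! ### Differentiation rules for pairs of Wirtinger derivatives. -/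

section Rules

variable {f g : ℂ → ℂ} {A B C D w : ℂ}

theorem HasFDerivAt.wirtinger_mul (hf : HasFDerivAt f (wirtinger A B) w)
    (hg : HasFDerivAt g (wirtinger C D) w) :
    HasFDerivAt (fun w => f w * g w) (wirtinger (A * g w + f w * C) (B * g w + f w * D)) w := by
  refine (hf.mul hg).congr_fderiv ?_
  ext h
  simp [wirtinger_apply]
  ring

theorem HasFDerivAt.wirtinger_add (hf : HasFDerivAt f (wirtinger A B) w)
    (hg : HasFDerivAt g (wirtinger C D) w) :
    HasFDerivAt (fun w => f w + g w) (wirtinger (A + C) (B + D)) w := by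
  refine (hf.add hg).congr_fderiv ?_
  ext h
  simp [wirtinger_apply]
  ring

theorem HasFDerivAt.wirtinger_comp {h : ℂ → ℂ} {h' : ℂ} (hh : HasDerivAt h h' (f w))
    (hf : HasFDerivAt f (wirtinger A B) w) :
    HasFDerivAt (fun w => h (f w)) (wirtinger (h' * A) (h' * B)) w := by
  refine ((hh.hasFDerivAt.restrictScalars ℝ).comp w hf).congr_fderiv ?_
  ext h
  simp [wirtinger_apply]
  ring

theorem HasFDerivAt.wirtinger_one_sub (hf : HasFDerivAt f (wirtinger A B) w) :
    HasFDerivAt (fun w => 1 - f w) (wirtinger (-A) (-B)) w := by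
  have := HasFDerivAt.wirtinger_comp ((hasDerivAt_id (f w)).const_sub 1) hf
  simpa using this

theorem HasFDerivAt.wirtinger_cpow (hf : HasFDerivAt f (wirtinger A B) w)
    (h0 : f w ∈ Complex.slitPlane) (c : ℂ) :
    HasFDerivAt (fun w => f w ^ c) (wirtinger (f w ^ c * (c * A / f w)) (f w ^ c * (c * B / f w)))
      w := by
  have h := HasFDerivAt.wirtinger_comp ((hasDerivAt_id (f w)).cpow_const (c := c) h0) hf
  have hne : f w ≠ 0 := Complex.slitPlane_ne_zero h0
  refine h.congr_fderiv ?_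
  simp only [id_eq, Complex.cpow_sub _ _ hne, Complex.cpow_one, mul_one]
  congr 1 <;> ring

theorem HasFDerivAt.wirtinger_inv (hf : HasFDerivAt f (wirtinger A B) w) (h0 : f w ≠ 0) :
    HasFDerivAt (fun w => (f w)⁻¹) (wirtinger (-A * (f w)⁻¹ ^ 2) (-B * (f w)⁻¹ ^ 2)) w := by
  refine (HasFDerivAt.wirtinger_comp (hasDerivAt_inv h0) hf).congr_fderiv ?_
  rw [inv_pow]
  congr 1 <;> ring

end Rules

/-! ### Derivatives and smoothness of the disc kernel. -/

section OneVariable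

variable {a b w : ℂ}

theorem one_sub_mem_slitPlane (hw : ‖w‖ < 1) : 1 - w ∈ Complex.slitPlane := by
  left
  have := (Complex.re_le_norm w).trans_lt hw
  simpa using this

theorem one_sub_mul_conj_mem_slitPlane (hw : ‖w‖ < 1) : 1 - w * conj w ∈ Complex.slitPlane := by
  refine one_sub_mem_slitPlane ?_
  rw [norm_mul, Complex.norm_conj]
  nlinarith [norm_nonneg w]

/-- A product of powers in `w` and `conj w`, without quotients or norms, is the form to which the
Wirtinger rules apply. -/
theorem discKernel_eq (a b w : ℂ) : discKernel a b w = poissonConst a b *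
    ((1 - w * conj w) ^ (a + b + 1) * ((1 - w) ^ (-(a + 1)) * (1 - conj w) ^ (-(b + 1)))) := by
  rw [discKernel, Complex.cpow_neg, Complex.cpow_neg, Complex.mul_conj, Complex.normSq_eq_norm_sq,
    div_eq_mul_inv, mul_inv]
  push_cast
  rfl

theorem hasFDerivAt_discKernel (a b : ℂ) (hw : ‖w‖ < 1) : HasFDerivAt (discKernel a b)
    (wirtinger
      (discKernel a b w * (-(a + b + 1) * conj w * (1 - w * conj w)⁻¹ + (a + 1) * (1 - w)⁻¹))
      (discKernel a b w * (-(a + b + 1) * w * (1 - w * conj w)⁻¹ + (b + 1) * (1 - conj w)⁻¹)))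
    w := by
  have hc : ‖conj w‖ < 1 := by rwa [Complex.norm_conj]
  have h1 := ((hasFDerivAt_wirtinger_id w).wirtinger_mul
    (hasFDerivAt_wirtinger_conj w)).wirtinger_one_sub.wirtinger_cpow
      (one_sub_mul_conj_mem_slitPlane hw) (a + b + 1)
  have h2 := (hasFDerivAt_wirtinger_id w).wirtinger_one_sub.wirtinger_cpow
      (one_sub_mem_slitPlane hw) (-(a + 1))
  have h3 := (hasFDerivAt_wirtinger_conj w).wirtinger_one_sub.wirtinger_cpow
      (one_sub_mem_slitPlane hc) (-(b + 1))
  have h := HasFDerivAt.wirtinger_comp ((hasDerivAt_id _).const_mul (poissonConst a b))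
    (h1.wirtinger_mul (h2.wirtinger_mul h3))
  rw [funext (discKernel_eq a b)]
  refine h.congr_fderiv ?_
  congr 1 <;> ring

/-- Only the `∂`-component of the differential of `∂̄` of the kernel enters the equation; the other
one is left unspecified. -/
theorem hasFDerivAt_discKernel_conjDeriv (a b : ℂ) (hw : ‖w‖ < 1) :
    ∃ B, HasFDerivAt (fun w => discKernel a b w *
        (-(a + b + 1) * w * (1 - w * conj w)⁻¹ + (b + 1) * (1 - conj w)⁻¹))
      (wirtinger (discKernel a b w *
        ((-(a + b + 1) * conj w * (1 - w * conj w)⁻¹ + (a + 1) * (1 - w)⁻¹)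
          * (-(a + b + 1) * w * (1 - w * conj w)⁻¹ + (b + 1) * (1 - conj w)⁻¹)
          - (a + b + 1) * ((1 - w * conj w)⁻¹ + w * conj w * (1 - w * conj w)⁻¹ ^ 2))) B) w := by
  have hc : ‖conj w‖ < 1 := by rwa [Complex.norm_conj]
  have h1 := ((hasFDerivAt_wirtinger_id w).wirtinger_mul
    (hasFDerivAt_wirtinger_conj w)).wirtinger_one_sub.wirtinger_inv
      (Complex.slitPlane_ne_zero (one_sub_mul_conj_mem_slitPlane hw))
  have h3 := (hasFDerivAt_wirtinger_conj w).wirtinger_one_sub.wirtinger_inv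
      (Complex.slitPlane_ne_zero (one_sub_mem_slitPlane hc))
  have h4 := HasFDerivAt.wirtinger_comp ((hasDerivAt_id _).const_mul (-(a + b + 1)))
    (hasFDerivAt_wirtinger_id w)
  have h5 := HasFDerivAt.wirtinger_comp ((hasDerivAt_id _).const_mul (b + 1)) h3
  have h := (hasFDerivAt_discKernel a b hw).wirtinger_mul ((h4.wirtinger_mul h1).wirtinger_add h5)
  refine ⟨_, h.congr_fderiv (congrArg₂ wirtinger ?_ rfl)⟩
  simp only [id]
  ring

theorem contDiffAt_cpow_const {f : ℂ → ℂ} (hf : ContDiffAt ℝ 2 f w)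
    (h0 : f w ∈ Complex.slitPlane) (c : ℂ) : ContDiffAt ℝ 2 (fun w => f w ^ c) w := by
  have h : ContDiffAt ℂ 2 (fun x : ℂ => x ^ c) (f w) :=
    (analyticAt_id.cpow analyticAt_const h0).contDiffAt
  exact (h.restrict_scalars ℝ).comp w hf

theorem contDiffAt_discKernel (a b : ℂ) (hw : ‖w‖ < 1) : ContDiffAt ℝ 2 (discKernel a b) w := by
  have hc : ‖conj w‖ < 1 := by rwa [Complex.norm_conj]
  have hconj : ContDiffAt ℝ 2 (fun w => conj w) w := Complex.conjCLE.contDiff.contDiffAt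
  rw [funext (discKernel_eq a b)]
  have h1 : ContDiffAt ℝ 2 (fun w => 1 - w * conj w) w :=
    contDiffAt_const.sub (contDiffAt_id.mul hconj)
  have h2 : ContDiffAt ℝ 2 (fun w : ℂ => 1 - w) w := contDiffAt_const.sub contDiffAt_id
  have h3 : ContDiffAt ℝ 2 (fun w => 1 - conj w) w := contDiffAt_const.sub hconj
  exact contDiffAt_const.mul
    ((contDiffAt_cpow_const h1 (one_sub_mul_conj_mem_slitPlane hw) _).mul
      ((contDiffAt_cpow_const h2 (one_sub_mem_slitPlane hw) _).mul
        (contDiffAt_cpow_const h3 (one_sub_mem_slitPlane hc) _)))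

theorem continuousOn_discKernel (a b : ℂ) : ContinuousOn (discKernel a b) {w | ‖w‖ < 1} :=
  fun _ hw => (contDiffAt_discKernel a b hw).continuousAt.continuousWithinAt

end OneVariable

section Wirtinger

variable {f : ℂ → ℂ} {A B : ℂ} {z : Fin 1 → ℂ}

theorem fderiv_comp_apply_zero (hf : HasFDerivAt f (wirtinger A B) (z 0)) (h : ℂ) :
    fderiv ℝ (fun z : Fin 1 → ℂ => f (z 0)) z (Pi.single 0 h) = A * h + B * conj h := by
  have := hf.comp z (ContinuousLinearMap.proj (R := ℝ) (φ := fun _ : Fin 1 => ℂ) 0).hasFDerivAt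
  have e : (fun z : Fin 1 → ℂ => f (z 0))
    = f ∘ (ContinuousLinearMap.proj (R := ℝ) (φ := fun _ : Fin 1 => ℂ) 0) := rfl
  rw [e, this.fderiv]
  simp [wirtinger_apply]

theorem dz_comp_apply_zero (hf : HasFDerivAt f (wirtinger A B) (z 0)) :
    dz 0 (fun z : Fin 1 → ℂ => f (z 0)) z = A := by
  rw [dz, fderiv_comp_apply_zero hf, fderiv_comp_apply_zero hf]
  simp only [map_one, Complex.conj_I]
  linear_combination (-(1 / 2 : ℂ) * A + 1 / 2 * B) * Complex.I_sq

theorem dzbar_comp_apply_zero (hf : HasFDerivAt f (wirtinger A B) (z 0)) :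
    dzbar 0 (fun z : Fin 1 → ℂ => f (z 0)) z = B := by
  rw [dzbar, fderiv_comp_apply_zero hf, fderiv_comp_apply_zero hf]
  simp only [map_one, Complex.conj_I]
  linear_combination ((1 / 2 : ℂ) * A - 1 / 2 * B) * Complex.I_sq

end Wirtinger

/-- Provides the comparison solution of the radial equation in each variable. -/
theorem isSepHarmonic_discKernel (a b : ℂ) :
    IsSepHarmonic (fun _ => a) (fun _ => b) (fun z : Fin 1 → ℂ => discKernel a b (z 0)) := by
  refine ⟨fun z hz => ?_, fun j z hz => ?_⟩
  · exact (ContDiffAt.comp z (contDiffAt_discKernel a b (hz 0))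
      (contDiff_apply ℝ ℂ 0).contDiffAt).contDiffWithinAt
  · obtain rfl : j = 0 := Subsingleton.elim _ _
    obtain ⟨B, hB⟩ := hasFDerivAt_discKernel_conjDeriv a b (hz 0)
    have h1 := hasFDerivAt_discKernel a b (hz 0)
    have e : dzbar 0 (fun z : Fin 1 → ℂ => discKernel a b (z 0)) =ᶠ[𝓝 z] fun z =>
        discKernel a b (z 0) * (-(a + b + 1) * z 0 * (1 - z 0 * conj (z 0))⁻¹
          + (b + 1) * (1 - conj (z 0))⁻¹) := by
      filter_upwards [isOpen_polydisc.mem_nhds hz] with y hy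
      exact dzbar_comp_apply_zero (hasFDerivAt_discKernel a b (hy 0))
    have h2 := dz_comp_apply_zero hB
    rw [dz, ← e.fderiv_eq, ← dz] at h2
    rw [opL, h2, dz_comp_apply_zero h1, dzbar_comp_apply_zero h1]
    have hn : (‖z 0‖ : ℂ) ^ 2 = z 0 * conj (z 0) := by
      rw [Complex.mul_conj, Complex.normSq_eq_norm_sq, Complex.ofReal_pow]
    have hc : ‖conj (z 0)‖ < 1 := by rw [Complex.norm_conj]; exact hz 0
    have n1 := Complex.slitPlane_ne_zero (one_sub_mul_conj_mem_slitPlane (hz 0))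
    have n2 := Complex.slitPlane_ne_zero (one_sub_mem_slitPlane (hz 0))
    have n3 := Complex.slitPlane_ne_zero (one_sub_mem_slitPlane hc)
    rw [hn]
    -- With `z` and `conj z` treated as independent variables, what remains is an identity of
    -- rational functions times the kernel.
    generalize conj (z 0) = y at *
    generalize z 0 = x at *
    field_simp
    ring

end DiscKernel

section BinomialCoefficients

open Filter Topology Set

/-! ### Coefficients of the binomial series and an Abelian theorem -/

/-- The coefficient `(c)_m / m!` of `w^m` in `(1 - w)^{-c}`. -/
noncomputable def risingCoeff (c : ℂ) (m : ℕ) : ℂ :=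
  (∏ j ∈ Finset.range m, (c + j)) / (m.factorial : ℂ)

theorem choose_eq_risingCoeff (c : ℂ) (m : ℕ) : Ring.choose (c + m - 1) m = risingCoeff c m := by
  have h := Ring.factorial_nsmul_multichoose_eq_ascPochhammer c m
  have hprod : (ascPochhammer ℂ m).eval c = ∏ j ∈ Finset.range m, (c + j) := by
    induction m with
    | zero => simp
    | succ m ih =>
      rw [ascPochhammer_succ_eval, Finset.prod_range_succ,
        ih (Ring.factorial_nsmul_multichoose_eq_ascPochhammer c m)]
  rw [Ring.multichoose_eq, Polynomial.ascPochhammer_smeval_eq_eval, hprod, nsmul_eq_mul] at h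
  rw [risingCoeff, ← h, mul_div_cancel_left₀ _ (by exact_mod_cast m.factorial_ne_zero)]

theorem hasSum_risingCoeff (c : ℂ) {w : ℂ} (hw : ‖w‖ < 1) :
    HasSum (fun m => risingCoeff c m * w ^ m) ((1 - w) ^ (-c)) := by
  have h := (Complex.one_div_one_sub_cpow_hasFPowerSeriesOnBall_zero c).hasSum_sub (y := w) (by
    rw [← ENNReal.ofReal_one, Metric.eball_ofReal]
    simpa using hw)
  rw [Complex.cpow_neg, ← one_div]
  refine h.congr_fun ?_
  intro m
  simp [← choose_eq_risingCoeff, mul_comm]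

theorem summable_norm_risingCoeff (c : ℂ) {t : ℝ} (ht : |t| < 1) :
    Summable fun m => ‖risingCoeff c m * (t : ℂ) ^ m‖ :=
  (hasSum_risingCoeff c (w := t) (by simpa using ht)).summable.norm

theorem risingCoeff_succ (c : ℂ) (m : ℕ) :
    risingCoeff c (m + 1) = risingCoeff c m * ((c + m) / (m + 1)) := by
  rw [risingCoeff, risingCoeff, Finset.prod_range_succ, Nat.factorial_succ]
  push_cast
  have : (m.factorial : ℂ) ≠ 0 := by exact_mod_cast m.factorial_ne_zero
  field_simp

theorem tendsto_add_div_self (c : ℂ) : Tendsto (fun m : ℕ => (c + m) / (m : ℂ)) atTop (𝓝 1) := by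
  have h : Tendsto (fun m : ℕ => c * ((m : ℂ))⁻¹ + 1) atTop (𝓝 (c * 0 + 1)) :=
    (tendsto_inv_atTop_nhds_zero_nat.const_mul c).add_const 1
  rw [mul_zero, zero_add] at h
  refine h.congr' ?_
  filter_upwards [eventually_ne_atTop 0] with m hm
  have : (m : ℂ) ≠ 0 := by exact_mod_cast hm
  field_simp

/-- Euler's limit: the expression is the reciprocal of `GammaSeq c m` times `(c + m) / m`, and the
last factor tends to `1`. -/
theorem tendsto_risingCoeff_mul_cpow {c : ℂ} (hc : ∀ m : ℕ, c ≠ -m) :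
    Tendsto (fun m : ℕ => risingCoeff c m * (m : ℂ) ^ (1 - c)) atTop (𝓝 (Complex.Gamma c)⁻¹) := by
  have h1 := (((Complex.GammaSeq_tendsto_Gamma c).mul (tendsto_add_div_self c))).inv₀
    (by simpa using Complex.Gamma_ne_zero hc)
  rw [mul_one] at h1
  refine h1.congr' ?_
  filter_upwards [eventually_ne_atTop 0] with m hm
  have hm0 : (m : ℂ) ≠ 0 := by exact_mod_cast hm
  have hne : ∀ j : ℕ, c + j ≠ 0 := fun j h => hc j (eq_neg_of_add_eq_zero_left h)
  have hprod : (∏ j ∈ Finset.range m, (c + j)) ≠ 0 := Finset.prod_ne_zero_iff.2 fun j _ => hne j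
  have hfac : (m.factorial : ℂ) ≠ 0 := by exact_mod_cast m.factorial_ne_zero
  have hpow : (m : ℂ) ^ c ≠ 0 := by simp [Complex.cpow_eq_zero_iff, hm0]
  rw [Complex.GammaSeq, risingCoeff, Finset.prod_range_succ, Complex.cpow_sub _ _ hm0,
    Complex.cpow_one]
  have := hne m
  field_simp

/-- Consecutive coefficients have ratio tending to `1`, so a fixed shift of the index keeps the
asymptotics. -/
theorem tendsto_risingCoeff_add_mul_cpow {c : ℂ} (hc : ∀ m : ℕ, c ≠ -m) (k : ℕ) :
    Tendsto (fun m : ℕ => risingCoeff c (m + k) * (m : ℂ) ^ (1 - c)) atTop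
      (𝓝 (Complex.Gamma c)⁻¹) := by
  induction k with
  | zero => simpa using tendsto_risingCoeff_mul_cpow hc
  | succ k ih =>
    have h := ih.mul ((tendsto_add_div_self (c + k)).div (tendsto_add_div_self (k + 1)) one_ne_zero)
    rw [div_one, mul_one] at h
    refine h.congr' ?_
    filter_upwards [eventually_ne_atTop 0] with m hm
    have hm0 : (m : ℂ) ≠ 0 := by exact_mod_cast hm
    have hm1 : ((k : ℂ) + 1 + m) ≠ 0 := by exact_mod_cast (by omega : k + 1 + m ≠ 0)
    have hm2 : ((m + k : ℕ) : ℂ) + 1 ≠ 0 := by exact_mod_cast (by omega : m + k + 1 ≠ 0)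
    rw [← add_assoc, risingCoeff_succ, Pi.div_apply]
    push_cast at hm2 ⊢
    field_simp
    ring

theorem risingCoeff_ne_zero {c : ℂ} (hc : ∀ m : ℕ, c ≠ -m) (m : ℕ) : risingCoeff c m ≠ 0 :=
  div_ne_zero (Finset.prod_ne_zero_iff.2 fun j _ h => hc j (eq_neg_of_add_eq_zero_left h))
    (by exact_mod_cast m.factorial_ne_zero)

theorem ne_neg_nat_of_re_pos {d : ℂ} (hd : 0 < d.re) (m : ℕ) : d ≠ -m := fun h => by
  rw [h] at hd
  simp at hd
  exact absurd hd (not_lt.2 (Nat.cast_nonneg m))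

/-- The coefficients of a product are asymptotic to those of the corresponding binomial series. -/
theorem tendsto_risingCoeff_mul_div {a b d : ℂ} (ha : ∀ m : ℕ, a ≠ -m) (hb : ∀ m : ℕ, b ≠ -m)
    (hd : ∀ m : ℕ, d ≠ -m) (habd : a + b = d + 1) (k : ℕ) :
    Tendsto (fun m => risingCoeff a (m + k) * risingCoeff b m / risingCoeff d m) atTop
      (𝓝 (Complex.Gamma d / (Complex.Gamma a * Complex.Gamma b))) := by
  have h := ((tendsto_risingCoeff_add_mul_cpow ha k).mul (tendsto_risingCoeff_mul_cpow hb)).div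
    (tendsto_risingCoeff_mul_cpow hd) (inv_ne_zero (Complex.Gamma_ne_zero hd))
  have e : (Complex.Gamma a)⁻¹ * (Complex.Gamma b)⁻¹ / (Complex.Gamma d)⁻¹
      = Complex.Gamma d / (Complex.Gamma a * Complex.Gamma b) := by
    rw [div_inv_eq_mul, ← mul_inv]; ring
  rw [e] at h
  refine h.congr' ?_
  filter_upwards [eventually_ne_atTop 0] with m hm
  have hm0 : (m : ℂ) ≠ 0 := by exact_mod_cast hm
  have hpow : ∀ c : ℂ, (m : ℂ) ^ c ≠ 0 := fun c => by simp [Complex.cpow_eq_zero_iff, hm0]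
  have hexp : (m : ℂ) ^ (1 - a) * (m : ℂ) ^ (1 - b) = (m : ℂ) ^ (1 - d) := by
    rw [← Complex.cpow_add _ _ hm0]
    congr 1
    linear_combination -habd
  have := risingCoeff_ne_zero hd m
  have := hpow (1 - d)
  rw [Pi.div_apply, div_eq_div_iff (mul_ne_zero ‹_› ‹_›) ‹_›, ← hexp]
  ring

/-- Both moduli grow like `m ^ (Re d - 1)`, so their quotient converges and is bounded. This passes
to a real exponent, where the coefficients are positive. -/
theorem exists_norm_risingCoeff_le {d : ℂ} (hd : 0 < d.re) :
    ∃ C, 0 ≤ C ∧ ∀ m, ‖risingCoeff d m‖ ≤ C * ‖risingCoeff (d.re : ℂ) m‖ := by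
  have hd' : ∀ m : ℕ, (d.re : ℂ) ≠ -m := ne_neg_nat_of_re_pos (by simpa using hd)
  have h := ((tendsto_risingCoeff_mul_cpow (ne_neg_nat_of_re_pos hd)).norm).div
    ((tendsto_risingCoeff_mul_cpow hd').norm)
    (by simpa using Complex.Gamma_ne_zero hd')
  have h2 : Tendsto (fun m => ‖risingCoeff d m‖ / ‖risingCoeff (d.re : ℂ) m‖) atTop
      (𝓝 (‖(Complex.Gamma d)⁻¹‖ / ‖(Complex.Gamma d.re)⁻¹‖)) := by
    refine h.congr' ?_
    filter_upwards [eventually_gt_atTop 0] with m hm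
    have hm0 : (0 : ℝ) < m := by exact_mod_cast hm
    simp only [Pi.div_apply, norm_mul]
    rw [← Complex.ofReal_natCast, Complex.norm_cpow_eq_rpow_re_of_pos hm0,
      Complex.norm_cpow_eq_rpow_re_of_pos hm0]
    simp only [Complex.sub_re, Complex.one_re, Complex.ofReal_re]
    exact mul_div_mul_right _ _ (Real.rpow_pos_of_pos hm0 _).ne'
  obtain ⟨C, hC⟩ := h2.bddAbove_range
  refine ⟨C, ?_, fun m => ?_⟩
  · exact (by positivity : (0 : ℝ) ≤ _).trans (hC ⟨0, rfl⟩)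
  · exact (div_le_iff₀ (norm_pos_iff.2 (risingCoeff_ne_zero hd' m))).1 (hC ⟨m, rfl⟩)

theorem hasSum_norm_risingCoeff {τ : ℝ} (hτ : 0 < τ) {x : ℝ} (hx : x ∈ Ico (0 : ℝ) 1) :
    HasSum (fun m => ‖risingCoeff (τ : ℂ) m‖ * x ^ m) ((1 - x) ^ (-τ)) := by
  have h := hasSum_risingCoeff (τ : ℂ) (w := x) (by simpa [abs_of_nonneg hx.1] using hx.2)
  have e : ∀ m, risingCoeff (τ : ℂ) m = (‖risingCoeff (τ : ℂ) m‖ : ℂ) := fun m => by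
    have h1 : risingCoeff (τ : ℂ) m
        = (((∏ j ∈ Finset.range m, (τ + j)) / (m.factorial : ℝ) : ℝ) : ℂ) := by
      rw [risingCoeff]; push_cast; rfl
    have h2 : 0 ≤ (∏ j ∈ Finset.range m, (τ + j)) / (m.factorial : ℝ) :=
      div_nonneg (Finset.prod_nonneg fun j _ => by positivity) (by positivity)
    rw [h1, Complex.norm_real, Real.norm_of_nonneg h2]
  rw [← Complex.hasSum_ofReal]
  have h3 : (((1 - x) ^ (-τ) : ℝ) : ℂ) = (1 - (x : ℂ)) ^ (-(τ : ℂ)) := by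
    rw [Complex.ofReal_cpow (by linarith [hx.2])]
    push_cast
    rfl
  rw [h3]
  refine h.congr_fun fun m => ?_
  push_cast
  rw [← e m]

/-- The sum is split at `N`: the head is bounded and is killed by `(1 - x)^τ`, while the tail is at
most `ε/2` times the majorant series, whose sum is `(1 - x)^{-τ}`. -/
theorem tendsto_abel {D : ℕ → ℝ} {τ : ℝ} (hτ : 0 < τ) (hD : ∀ m, 0 ≤ D m)
    (hsum : ∀ x ∈ Ico (0 : ℝ) 1, HasSum (fun m => D m * x ^ m) ((1 - x) ^ (-τ)))
    {e : ℕ → ℂ} (he : ∀ ε > 0, ∀ᶠ m in atTop, ‖e m‖ ≤ ε * D m) :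
    Tendsto (fun x : ℝ => (1 - x) ^ τ * ‖∑' m, e m * (x : ℂ) ^ m‖) (𝓝[<] 1) (𝓝 0) := by
  rw [Metric.tendsto_nhds]
  intro ε hε
  obtain ⟨N, hN⟩ := eventually_atTop.1 (he (ε / 2) (by positivity))
  let K := ∑ m ∈ Finset.range N, ‖e m‖
  have hK : 0 ≤ K := Finset.sum_nonneg fun _ _ => norm_nonneg _
  have hbound : ∀ x ∈ Ico (0 : ℝ) 1,
      (1 - x) ^ τ * ‖∑' m, e m * (x : ℂ) ^ m‖ ≤ (1 - x) ^ τ * K + ε / 2 := by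
    intro x hx
    have hx1 : 0 < 1 - x := by linarith [hx.2]
    have hterm : ∀ m, ‖e m * (x : ℂ) ^ m‖
        ≤ (if m ∈ Finset.range N then ‖e m‖ else 0) + ε / 2 * (D m * x ^ m) := by
      intro m
      have hxm : x ^ m ≤ 1 := pow_le_one₀ hx.1 hx.2.le
      have hxm0 : 0 ≤ x ^ m := pow_nonneg hx.1 m
      rw [norm_mul, norm_pow, Complex.norm_real, Real.norm_of_nonneg hx.1]
      split_ifs with h
      · have := mul_le_of_le_one_right (norm_nonneg (e m)) hxm
        have := mul_nonneg (hD m) hxm0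
        nlinarith
      · have := hN m (by simpa using h)
        nlinarith
    have hs1 : HasSum (fun m => if m ∈ Finset.range N then ‖e m‖ else 0) K := by
      have := hasSum_sum_of_ne_finset_zero (L := SummationFilter.unconditional ℕ)
        (f := fun m => if m ∈ Finset.range N then ‖e m‖ else 0)
        (s := Finset.range N) (fun b hb => if_neg hb)
      convert this using 1
      exact Finset.sum_congr rfl fun m hm => (if_pos hm).symm
    have hs := hs1.add ((hsum x hx).mul_left (ε / 2))
    have h1 := tsum_of_norm_bounded hs hterm
    calc (1 - x) ^ τ * ‖∑' m, e m * (x : ℂ) ^ m‖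
        ≤ (1 - x) ^ τ * (K + ε / 2 * (1 - x) ^ (-τ)) := by gcongr
      _ = (1 - x) ^ τ * K + ε / 2 * ((1 - x) ^ τ * (1 - x) ^ (-τ)) := by ring
      _ = _ := by rw [← Real.rpow_add hx1, add_neg_cancel, Real.rpow_zero, mul_one]
  have hlim : Tendsto (fun x : ℝ => (1 - x) ^ τ * K) (𝓝[<] 1) (𝓝 0) := by
    have : ContinuousAt (fun x : ℝ => (1 - x) ^ τ * K) 1 :=
      ((continuousAt_const.sub continuousAt_id).rpow_const (Or.inr hτ.le)).mul continuousAt_const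
    have h := this.tendsto
    simp only [sub_self, Real.zero_rpow hτ.ne', zero_mul] at h
    exact h.mono_left nhdsWithin_le_nhds
  have hev := hlim.eventually (gt_mem_nhds (show (0 : ℝ) < ε / 2 by positivity))
  filter_upwards [hev, Ioo_mem_nhdsLT (show (0 : ℝ) < 1 by simp)] with x hx hx01
  have h0 : 0 ≤ (1 - x) ^ τ * ‖∑' m, e m * (x : ℂ) ^ m‖ :=
    mul_nonneg (Real.rpow_nonneg (by linarith [hx01.2]) _) (norm_nonneg _)
  rw [Real.dist_eq, sub_zero, abs_of_nonneg h0]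
  linarith [hbound x ⟨hx01.1.le, hx01.2⟩]

/-- The leading singularity of a hypergeometric series at `1`. Its coefficients are asymptotic to
`Γ` times those of `(1 - x)^{-d}`; subtracting that series leaves an error covered by
`tendsto_abel`, because `|(1 - x)^d| = (1 - x)^{Re d}`. -/
theorem tendsto_cpow_mul_tsum_risingCoeff {a b d : ℂ} (ha : ∀ m : ℕ, a ≠ -m)
    (hb : ∀ m : ℕ, b ≠ -m) (hd : 0 < d.re) (habd : a + b = d + 1) (k : ℕ)
    (hsumm : ∀ x ∈ Ico (0 : ℝ) 1,
      Summable fun m => risingCoeff a (m + k) * risingCoeff b m * (x : ℂ) ^ m) :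
    Tendsto (fun x : ℝ => (1 - (x : ℂ)) ^ d *
        ∑' m, risingCoeff a (m + k) * risingCoeff b m * (x : ℂ) ^ m) (𝓝[<] 1)
      (𝓝 (Complex.Gamma d / (Complex.Gamma a * Complex.Gamma b))) := by
  set Γ := Complex.Gamma d / (Complex.Gamma a * Complex.Gamma b)
  have hd' := ne_neg_nat_of_re_pos hd
  obtain ⟨C, hC0, hC⟩ := exists_norm_risingCoeff_le hd
  have hlim := tendsto_risingCoeff_mul_div ha hb hd' habd k
  let e : ℕ → ℂ := fun m => risingCoeff a (m + k) * risingCoeff b m - Γ * risingCoeff d m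
  have he : ∀ ε > 0, ∀ᶠ m in atTop, ‖e m‖ ≤ ε * ‖risingCoeff (d.re : ℂ) m‖ := by
    intro ε hε
    have hε' : 0 < ε / (C + 1) := by positivity
    filter_upwards [(Metric.tendsto_nhds.1 hlim) _ hε'] with m hm
    rw [dist_eq_norm] at hm
    have e1 : e m = (risingCoeff a (m + k) * risingCoeff b m / risingCoeff d m - Γ)
        * risingCoeff d m := by
      rw [sub_mul, div_mul_cancel₀ _ (risingCoeff_ne_zero hd' m)]
    rw [e1, norm_mul]
    calc _ ≤ ε / (C + 1) * (C * ‖risingCoeff (d.re : ℂ) m‖) :=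
          mul_le_mul hm.le (hC m) (norm_nonneg _) hε'.le
      _ = ε * ‖risingCoeff (d.re : ℂ) m‖ * (C / (C + 1)) := by ring
      _ ≤ ε * ‖risingCoeff (d.re : ℂ) m‖ * 1 := by
          gcongr
          exact (div_le_one (by positivity)).2 (by linarith)
      _ = _ := mul_one _
  have habel := tendsto_abel hd (fun m => norm_nonneg (risingCoeff (d.re : ℂ) m))
    (fun x hx => hasSum_norm_risingCoeff hd hx) he
  rw [tendsto_iff_norm_sub_tendsto_zero]
  refine habel.congr' ?_
  filter_upwards [Ioo_mem_nhdsLT (show (0 : ℝ) < 1 by simp)] with x hx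
  have hx1 : (0 : ℝ) < 1 - x := by linarith [hx.2]
  have hxc : ((1 - x : ℝ) : ℂ) ≠ 0 := by exact_mod_cast hx1.ne'
  have hB := (hasSum_risingCoeff d (w := x) (by simpa [abs_of_pos hx.1] using hx.2)).mul_left Γ
  have hA := (hsumm x ⟨hx.1.le, hx.2⟩).hasSum
  have hE : ∑' m, e m * (x : ℂ) ^ m
      = (∑' m, risingCoeff a (m + k) * risingCoeff b m * (x : ℂ) ^ m)
        - Γ * (1 - (x : ℂ)) ^ (-d) := by
    rw [← (hA.sub hB).tsum_eq]
    exact tsum_congr fun m => by simp only [e]; ring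
  have hcast : (1 - (x : ℂ)) = ((1 - x : ℝ) : ℂ) := by push_cast; rfl
  rw [hE, ← Complex.norm_cpow_eq_rpow_re_of_pos hx1, ← norm_mul, hcast, mul_sub,
    mul_left_comm, ← Complex.cpow_add _ _ hxc, add_neg_cancel, Complex.cpow_zero, mul_one]

end BinomialCoefficients

section RadialLimit

open Filter Topology Set

/-! ### Radial limits of the Fourier coefficients of the kernel -/

theorem radialCoeff_comp_apply_zero (f : ℂ → ℂ) (k : ℤ) (t : ℝ) :
    radialCoeff (fun z => f (z 0)) k t
      = ∫ ζ : Circle, f (t * (ζ : ℂ)) * (ζ : ℂ) ^ (-k) ∂circleHaar := by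
  have h := integral_fintype_prod_eq_prod (ι := Fin 1) (𝕜 := ℂ)
    (fun (_ : Fin 1) (ζ : Circle) => f (t * (ζ : ℂ)) * (ζ : ℂ) ^ (-k)) (μ := fun _ => circleHaar)
  simpa [radialCoeff, coeff, polar, chi, torusHaar] using h

theorem continuous_circle_zpow (k : ℤ) : Continuous fun ζ : Circle => (ζ : ℂ) ^ k :=
  Continuous.zpow₀ (by fun_prop) _ fun ζ => Or.inl (coe_ne_zero _)

theorem integral_circle_zpow (k : ℤ) :
    ∫ ζ : Circle, (ζ : ℂ) ^ k ∂circleHaar = if k = 0 then 1 else 0 := by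
  split_ifs with h
  · simp [h]
  -- Rotation by `e^{iπ/k}` changes the sign of `ζ^k`, so the integral equals its own negative.
  · have hinv := integral_mul_left_eq_self (μ := circleHaar) (fun ζ : Circle => (ζ : ℂ) ^ k)
      (Circle.exp (Real.pi / k))
    have hk : (k : ℂ) ≠ 0 := by exact_mod_cast h
    have hexp : ((Circle.exp (Real.pi / k) : Circle) : ℂ) ^ k = -1 := by
      rw [Circle.coe_exp, ← Complex.exp_int_mul, ← Complex.exp_pi_mul_I]
      congr 1
      push_cast
      field_simp
    simp only [Circle.coe_mul, mul_zpow, hexp, integral_const_mul] at hinv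
    linear_combination (-1 / 2 : ℂ) * hinv

/-- Termwise integration of an absolutely convergent trigonometric series. -/
theorem hasSum_integral_circle {c : ℕ → ℂ} (hc : Summable fun m => ‖c m‖) (e : ℕ → ℤ)
    {φ : Circle → ℂ} (hφ : Continuous φ) :
    HasSum (fun m => c m * ∫ ζ : Circle, (ζ : ℂ) ^ e m * φ ζ ∂circleHaar)
      (∫ ζ : Circle, (∑' m, c m * (ζ : ℂ) ^ e m) * φ ζ ∂circleHaar) := by
  obtain ⟨C, hC⟩ := isCompact_univ.exists_bound_of_continuousOn hφ.continuousOn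
  have hcont : ∀ m, Continuous fun ζ : Circle => c m * ((ζ : ℂ) ^ e m * φ ζ) := fun m =>
    continuous_const.mul ((continuous_circle_zpow _).mul hφ)
  have hnorm : ∀ m (ζ : Circle), ‖c m * ((ζ : ℂ) ^ e m * φ ζ)‖ ≤ ‖c m‖ * C := fun m ζ => by
    rw [norm_mul, norm_mul, norm_zpow, Circle.norm_coe ζ, one_zpow, one_mul]
    gcongr
    exact hC ζ (mem_univ _)
  have h := hasSum_integral_of_summable_integral_norm (μ := circleHaar)
    (F := fun m (ζ : Circle) => c m * ((ζ : ℂ) ^ e m * φ ζ))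
    (fun m => integrable_of_continuous (hcont m)) (by
      refine Summable.of_nonneg_of_le (fun m => integral_nonneg fun _ => norm_nonneg _)
        (fun m => ?_) (hc.mul_right C)
      refine (integral_mono_of_nonneg (.of_forall fun _ => norm_nonneg _) (integrable_const _)
        (.of_forall (hnorm m))).trans ?_
      simp)
  simp only [integral_const_mul] at h
  have e : ∀ ζ : Circle, (∑' m, c m * (ζ : ℂ) ^ e m) * φ ζ
      = ∑' m, c m * ((ζ : ℂ) ^ e m * φ ζ) := fun ζ => by
    rw [← tsum_mul_right]
    exact tsum_congr fun m => by ring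
  simpa only [e] using h

theorem integral_one_sub_cpow_mul_zpow (c : ℂ) {t : ℝ} (ht : |t| < 1) (N : ℕ) :
    ∫ ζ : Circle, (1 - t * (ζ : ℂ)) ^ (-c) * (ζ : ℂ) ^ (-(N : ℤ)) ∂circleHaar
      = risingCoeff c N * (t : ℂ) ^ N := by
  have h := hasSum_integral_circle (summable_norm_risingCoeff c ht) (fun m => (m : ℤ))
    (continuous_circle_zpow (-(N : ℤ)))
  have e : ∀ ζ : Circle, ∑' m : ℕ, risingCoeff c m * (t : ℂ) ^ m * (ζ : ℂ) ^ (m : ℤ)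
      = (1 - t * (ζ : ℂ)) ^ (-c) := fun ζ => by
    rw [← (hasSum_risingCoeff c (w := t * ζ) (by simpa [Circle.norm_coe ζ] using ht)).tsum_eq]
    exact tsum_congr fun m => by rw [zpow_natCast, mul_pow, mul_assoc]
  simp only [e] at h
  refine h.unique ?_
  have h2 := hasSum_single (L := SummationFilter.unconditional ℕ)
    (f := fun m : ℕ => risingCoeff c m * (t : ℂ) ^ m *
    ∫ ζ : Circle, (ζ : ℂ) ^ (m : ℤ) * (ζ : ℂ) ^ (-(N : ℤ)) ∂circleHaar) N (by
      intro m hm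
      simp only [← zpow_add₀ (coe_ne_zero _), integral_circle_zpow]
      rw [if_neg (by omega), mul_zero])
  convert h2 using 1
  simp only [← zpow_add₀ (coe_ne_zero _), integral_circle_zpow]
  simp

theorem norm_ofReal_mul_circle_lt {t : ℝ} (ht : |t| < 1) (ζ : Circle) : ‖(t : ℂ) * ζ‖ < 1 := by
  simpa [Circle.norm_coe ζ] using ht

/-- Only the factor in `conj ζ` is expanded; each resulting integral is a Taylor coefficient of the
other factor, with index shifted by `k`. -/
theorem hasSum_integral_cpow_mul_cpow (a b : ℂ) {t : ℝ} (ht : |t| < 1) (k : ℕ) :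
    HasSum (fun m => risingCoeff a (m + k) * risingCoeff b m * (t : ℂ) ^ (2 * m + k))
      (∫ ζ : Circle, (1 - t * (ζ : ℂ)) ^ (-a) * (1 - t * (conj (ζ : ℂ))) ^ (-b)
        * (ζ : ℂ) ^ (-(k : ℤ)) ∂circleHaar) := by
  have hcont : Continuous fun ζ : Circle => (1 - t * (ζ : ℂ)) ^ (-a) * (ζ : ℂ) ^ (-(k : ℤ)) := by
    refine Continuous.mul ?_ (continuous_circle_zpow _)
    refine Continuous.cpow (by fun_prop) continuous_const fun ζ => ?_
    exact one_sub_mem_slitPlane (norm_ofReal_mul_circle_lt ht ζ)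
  have h := hasSum_integral_circle (summable_norm_risingCoeff b ht) (fun m => -(m : ℤ)) hcont
  have e : ∀ ζ : Circle, ∑' m : ℕ, risingCoeff b m * (t : ℂ) ^ m * (ζ : ℂ) ^ (-(m : ℤ))
      = (1 - t * (conj (ζ : ℂ))) ^ (-b) := fun ζ => by
    rw [← (hasSum_risingCoeff b (w := t * conj (ζ : ℂ))
      (by simpa [Circle.norm_coe ζ] using ht)).tsum_eq]
    refine tsum_congr fun m => ?_
    rw [zpow_neg, zpow_natCast, mul_pow, mul_assoc, ← inv_pow, ← Circle.coe_inv,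
      Circle.coe_inv_eq_conj]
  have e2 : ∀ m : ℕ, ∫ ζ : Circle, (ζ : ℂ) ^ (-(m : ℤ)) *
      ((1 - t * (ζ : ℂ)) ^ (-a) * (ζ : ℂ) ^ (-(k : ℤ))) ∂circleHaar
      = risingCoeff a (m + k) * (t : ℂ) ^ (m + k) := fun m => by
    rw [← integral_one_sub_cpow_mul_zpow a ht]
    refine integral_congr_ae (.of_forall fun ζ => ?_)
    simp only
    rw [mul_left_comm, ← zpow_add₀ (coe_ne_zero _)]
    push_cast
    congr 2
    ring
  simp only [e, e2] at h
  convert h using 1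
  · funext m; ring
  · refine integral_congr_ae (.of_forall fun ζ => ?_)
    simp only
    ring

theorem radialCoeff_discKernel_eq (a b : ℂ) (k : ℤ) (t : ℝ) :
    radialCoeff (fun z => discKernel a b (z 0)) k t
      = poissonConst a b * (1 - (t : ℂ) ^ 2) ^ (a + b + 1) *
        ∫ ζ : Circle, (1 - t * (ζ : ℂ)) ^ (-(a + 1)) * (1 - t * (conj (ζ : ℂ))) ^ (-(b + 1))
          * (ζ : ℂ) ^ (-k) ∂circleHaar := by
  rw [radialCoeff_comp_apply_zero, ← integral_const_mul]
  refine integral_congr_ae (.of_forall fun ζ => ?_)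
  have h : (t : ℂ) * ζ * conj ((t : ℂ) * ζ) = (t : ℂ) ^ 2 := by
    rw [Complex.mul_conj, Complex.normSq_eq_norm_sq, norm_mul, Circle.norm_coe ζ,
      Complex.norm_real, mul_one, Real.norm_eq_abs, sq_abs, Complex.ofReal_pow]
  simp only [discKernel_eq, h]
  rw [map_mul, Complex.conj_ofReal]
  ring

/-- The substitution `ζ ↦ ζ⁻¹` exchanges `w` and `conj w`, hence `a` and `b`, and reduces negative
frequencies to positive ones. -/
theorem radialCoeff_discKernel_neg (a b : ℂ) (k : ℤ) (t : ℝ) :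
    radialCoeff (fun z => discKernel a b (z 0)) (-k) t
      = radialCoeff (fun z => discKernel b a (z 0)) k t := by
  rw [radialCoeff_discKernel_eq, radialCoeff_discKernel_eq, ← integral_inv_eq_self]
  have hc : poissonConst a b = poissonConst b a := by
    rw [poissonConst, poissonConst, add_comm a b, mul_comm (Complex.Gamma (a + 1))]
  rw [hc, add_comm a b]
  congr 1
  refine integral_congr_ae (.of_forall fun ζ => ?_)
  simp only [Circle.coe_inv_eq_conj, Complex.conj_conj]
  rw [← Circle.coe_inv_eq_conj, Circle.coe_inv, inv_zpow', neg_neg]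
  ring

/-- With `x = t²` the coefficient is `poissonConst a b` times `t^k (1 - x)^{a+b+1}` times a
hypergeometric series in `x`. The constant is the reciprocal of the limit of the remaining factors.
-/
theorem tendsto_radialCoeff_discKernel_nat {a b : ℂ} (hab : -1 < a.re + b.re)
    (ha : ∀ k : ℕ, a ≠ -((k : ℂ) + 1)) (hb : ∀ k : ℕ, b ≠ -((k : ℂ) + 1)) (k : ℕ) :
    Tendsto (radialCoeff (fun z => discKernel a b (z 0)) (k : ℤ)) (𝓝[<] 1) (𝓝 1) := by
  have ha' : ∀ m : ℕ, a + 1 ≠ -m := fun m h => ha m (by linear_combination h)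
  have hb' : ∀ m : ℕ, b + 1 ≠ -m := fun m h => hb m (by linear_combination h)
  have hd : 0 < (a + b + 1).re := by simp; linarith
  have hsum : ∀ t : ℝ, |t| < 1 → HasSum
      (fun m => risingCoeff (a + 1) (m + k) * risingCoeff (b + 1) m * (t : ℂ) ^ (2 * m + k)) _ :=
    fun t ht => hasSum_integral_cpow_mul_cpow (a + 1) (b + 1) ht k
  have hsumm : ∀ x ∈ Ico (0 : ℝ) 1, Summable fun m =>
      risingCoeff (a + 1) (m + k) * risingCoeff (b + 1) m * (x : ℂ) ^ m := by
    intro x hx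
    -- For `x > 0` summability is taken from the series at `t = √x` after division by `t^k`, which
    -- is why `x = 0` is separate.
    rcases hx.1.eq_or_lt with rfl | h0
    · refine summable_of_ne_finset_zero (s := {0}) fun m hm => ?_
      simp [show m ≠ 0 by simpa using hm]
    · have hs : |Real.sqrt x| < 1 := by
        rw [abs_of_nonneg (Real.sqrt_nonneg _)]
        exact (Real.sqrt_lt' one_pos).2 (by simpa using hx.2)
      have hne : ((Real.sqrt x : ℝ) : ℂ) ^ k ≠ 0 :=
        pow_ne_zero _ (by exact_mod_cast (Real.sqrt_pos.2 h0).ne')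
      refine ((hsum _ hs).summable.div_const ((Real.sqrt x : ℂ) ^ k)).congr fun m => ?_
      rw [pow_add, pow_mul, ← Complex.ofReal_pow, Real.sq_sqrt hx.1]
      field_simp
  have hlim := tendsto_cpow_mul_tsum_risingCoeff ha' hb' hd (by ring) k hsumm
  have hsq : Tendsto (fun t : ℝ => t ^ 2) (𝓝[<] 1) (𝓝[<] 1) := by
    refine tendsto_nhdsWithin_iff.2 ⟨?_, ?_⟩
    · have : Tendsto (fun t : ℝ => t ^ 2) (𝓝 1) (𝓝 (1 ^ 2)) := (continuous_pow 2).tendsto 1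
      rw [one_pow] at this
      exact this.mono_left nhdsWithin_le_nhds
    · filter_upwards [Ioo_mem_nhdsLT (show (0 : ℝ) < 1 by simp)] with t ht
      exact pow_lt_one₀ ht.1.le ht.2 two_ne_zero
  have hpow : Tendsto (fun t : ℝ => (t : ℂ) ^ k) (𝓝[<] 1) (𝓝 1) := by
    have : Tendsto (fun t : ℝ => (t : ℂ) ^ k) (𝓝 1) (𝓝 (((1 : ℝ) : ℂ) ^ k)) :=
      (Complex.continuous_ofReal.pow k).tendsto 1
    rw [Complex.ofReal_one, one_pow] at this
    exact this.mono_left nhdsWithin_le_nhds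
  have h := ((hlim.comp hsq).mul hpow).const_mul (poissonConst a b)
  have hone : poissonConst a b * (Complex.Gamma (a + b + 1) /
      (Complex.Gamma (a + 1) * Complex.Gamma (b + 1)) * 1) = 1 := by
    have h1 := Complex.Gamma_ne_zero ha'
    have h2 := Complex.Gamma_ne_zero hb'
    have h3 := Complex.Gamma_ne_zero_of_re_pos hd
    rw [poissonConst]
    field_simp
  rw [hone] at h
  refine h.congr' ?_
  filter_upwards [Ioo_mem_nhdsLT (show (0 : ℝ) < 1 by simp)] with t ht
  have ht1 : |t| < 1 := by rw [abs_of_pos ht.1]; exact ht.2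
  rw [radialCoeff_discKernel_eq, ← (hsum t ht1).tsum_eq]
  simp only [Function.comp_apply, Complex.ofReal_pow]
  rw [mul_assoc, mul_assoc, ← tsum_mul_right]
  congr 2
  exact tsum_congr fun m => by ring

theorem tendsto_radialCoeff_discKernel {a b : ℂ} (hab : -1 < a.re + b.re)
    (ha : ∀ k : ℕ, a ≠ -((k : ℂ) + 1)) (hb : ∀ k : ℕ, b ≠ -((k : ℂ) + 1)) (k : ℤ) :
    Tendsto (radialCoeff (fun z => discKernel a b (z 0)) k) (𝓝[<] 1) (𝓝 1) := by
  obtain ⟨m, rfl | rfl⟩ := k.eq_nat_or_neg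
  · exact tendsto_radialCoeff_discKernel_nat hab ha hb m
  · simp only [funext (radialCoeff_discKernel_neg a b m)]
    exact tendsto_radialCoeff_discKernel_nat (by linarith) hb ha m

end RadialLimit

section FourierUniqueness

open Filter Topology Set

/-! ### Uniqueness of Fourier coefficients on the torus -/

variable {n : ℕ}

/-- The character `ζ ↦ ζ^k` as a continuous map. -/
noncomputable def chiMap (k : Fin n → ℤ) : C(Torus n, ℂ) := ⟨chi k, continuous_chi k⟩

/-- The star subalgebra of trigonometric polynomials. -/
noncomputable def trigSubalgebra (n : ℕ) : StarSubalgebra ℂ C(Torus n, ℂ) where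
  toSubalgebra := Algebra.adjoin ℂ (range chiMap)
  star_mem' := by
    change Algebra.adjoin ℂ (range chiMap) ≤ star (Algebra.adjoin ℂ (range chiMap))
    refine Algebra.adjoin_le ?_
    rintro _ ⟨k, rfl⟩
    refine Algebra.subset_adjoin ⟨-k, ?_⟩
    ext1 ζ
    exact (conj_chi k ζ).symm

/-- The characters contain `1` and are closed under products, so the algebra they generate is their
linear span. -/
theorem trigSubalgebra_coe :
    (trigSubalgebra n).toSubalgebra.toSubmodule = Submodule.span ℂ (range chiMap) := by
  apply Algebra.adjoin_eq_span_of_subset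
  refine .trans (fun x ↦ Submonoid.closure_induction (fun _ ↦ id) ⟨0, ?_⟩ ?_) Submodule.subset_span
  · ext ζ
    simp [chiMap, chi]
  · rintro _ _ _ _ ⟨k, rfl⟩ ⟨l, rfl⟩
    refine ⟨k + l, ?_⟩
    ext ζ
    exact chi_add k l ζ

theorem trigSubalgebra_separatesPoints : (trigSubalgebra n).SeparatesPoints := by
  intro ζ η h
  obtain ⟨i, hi⟩ := Function.ne_iff.1 h
  refine ⟨_, ⟨chiMap (Pi.single i 1), Algebra.subset_adjoin ⟨_, rfl⟩, rfl⟩, ?_⟩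
  have e : ∀ ζ : Torus n, chi (Pi.single i 1) ζ = (ζ i : ℂ) := fun ζ => by
    rw [chi, Finset.prod_eq_single i]
    · simp
    · intro j _ hj
      simp [hj]
    · simp
  change chi _ ζ ≠ chi _ η
  rw [e, e]
  exact fun h => hi (Circle.ext h)

theorem span_chiMap_closure_eq_top :
    (Submodule.span ℂ (range (chiMap (n := n)))).topologicalClosure = ⊤ := by
  rw [← trigSubalgebra_coe]
  exact congr_arg (Subalgebra.toSubmodule <| StarSubalgebra.toSubalgebra ·)
    (ContinuousMap.starSubalgebra_topologicalClosure_eq_top_of_separatesPoints _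
      trigSubalgebra_separatesPoints)

theorem integrable_mul_continuous {K : Type*} [TopologicalSpace K] [CompactSpace K]
    [MeasurableSpace K] [BorelSpace K] {μ : Measure K} {f : K → ℂ}
    (hf : Integrable f μ) {g : K → ℂ} (hg : Continuous g) : Integrable (fun x => f x * g x) μ := by
  obtain ⟨C, hC⟩ := isCompact_univ.exists_bound_of_continuousOn hg.continuousOn
  exact hf.mul_bdd (c := C) hg.aestronglyMeasurable (.of_forall fun x => hC x (mem_univ _))

theorem integral_mul_eq_zero_of_chi {f : Torus n → ℂ} (hf : Integrable f (torusHaar n))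
    (h : ∀ k, ∫ ζ, f ζ * chi k ζ ∂(torusHaar n) = 0) (g : C(Torus n, ℂ)) :
    ∫ ζ, f ζ * g ζ ∂(torusHaar n) = 0 := by
  have hspan : ∀ g ∈ Submodule.span ℂ (range (chiMap (n := n))),
      ∫ ζ, f ζ * g ζ ∂(torusHaar n) = 0 := by
    intro g hg
    induction hg using Submodule.span_induction with
    | mem g hg => obtain ⟨k, rfl⟩ := hg; exact h k
    | zero => simp
    | add g₁ g₂ _ _ h₁ h₂ =>
      simp only [ContinuousMap.add_apply, mul_add]
      rw [integral_add (integrable_mul_continuous hf g₁.continuous)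
        (integrable_mul_continuous hf g₂.continuous), h₁, h₂, add_zero]
    | smul c g _ hg =>
      simp only [ContinuousMap.smul_apply, smul_eq_mul, mul_left_comm]
      rw [integral_const_mul, hg, mul_zero]
  have hmem : g ∈ (Submodule.span ℂ (range (chiMap (n := n)))).topologicalClosure := by
    rw [span_chiMap_closure_eq_top]; trivial
  have hcl : g ∈ closure (Submodule.span ℂ (range (chiMap (n := n))) : Set C(Torus n, ℂ)) := hmem
  rw [Metric.mem_closure_iff] at hcl
  have hbound : ∀ ε > 0, ‖∫ ζ, f ζ * g ζ ∂(torusHaar n)‖ ≤ ε * ∫ ζ, ‖f ζ‖ ∂(torusHaar n) := by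
    intro ε hε
    obtain ⟨g', hg', hd⟩ := hcl ε hε
    have e : ∫ ζ, f ζ * g ζ ∂(torusHaar n) = ∫ ζ, f ζ * (g ζ - g' ζ) ∂(torusHaar n) := by
      simp only [mul_sub]
      rw [integral_sub (integrable_mul_continuous hf g.continuous)
        (integrable_mul_continuous hf g'.continuous), hspan g' hg', sub_zero]
    rw [e, ← integral_const_mul]
    refine norm_integral_le_of_norm_le (hf.norm.const_mul _) (.of_forall fun ζ => ?_)
    rw [norm_mul, mul_comm]
    gcongr
    rw [← dist_eq_norm]
    exact (ContinuousMap.dist_apply_le_dist ζ).trans hd.le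
  rw [← norm_le_zero_iff]
  refine ge_of_tendsto (x := 𝓝[>] (0 : ℝ)) (f := fun ε => ε * ∫ ζ, ‖f ζ‖ ∂(torusHaar n)) ?_ ?_
  · have : Tendsto (fun ε : ℝ => ε * ∫ ζ, ‖f ζ‖ ∂(torusHaar n)) (𝓝 0)
        (𝓝 (0 * ∫ ζ, ‖f ζ‖ ∂(torusHaar n))) := (continuous_mul_const _).tendsto 0
    rw [zero_mul] at this
    exact this.mono_left nhdsWithin_le_nhds
  · filter_upwards [self_mem_nhdsWithin] with ε hε using hbound ε hε

/-- The indicator of a closed set is a bounded pointwise limit of continuous functions, so the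
integrals of `f` over closed sets vanish. -/
theorem ae_eq_zero_of_integral_mul_continuous {f : Torus n → ℂ} (hf : Integrable f (torusHaar n))
    (h : ∀ g : C(Torus n, ℂ), ∫ ζ, f ζ * g ζ ∂(torusHaar n) = 0) : f =ᵐ[torusHaar n] 0 := by
  refine ae_eq_zero_of_forall_setIntegral_isClosed_eq_zero hf fun s hs => ?_
  have hlim : Tendsto (fun m => ∫ ζ, f ζ * ((hs.apprSeq m ζ : ℝ) : ℂ) ∂(torusHaar n)) atTop
      (𝓝 (∫ ζ, s.indicator f ζ ∂(torusHaar n))) := by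
    refine tendsto_integral_of_dominated_convergence (fun ζ => ‖f ζ‖) (fun m => ?_) hf.norm
      (fun m => .of_forall fun ζ => ?_) (.of_forall fun ζ => ?_)
    · refine hf.aestronglyMeasurable.mul (Continuous.aestronglyMeasurable ?_)
      have := (hs.apprSeq m).continuous
      fun_prop
    · have : ‖((hs.apprSeq m ζ : ℝ) : ℂ)‖ ≤ 1 := by
        rw [Complex.norm_real, Real.norm_of_nonneg (NNReal.coe_nonneg _)]
        exact_mod_cast HasOuterApproxClosed.apprSeq_apply_le_one hs m ζ
      rw [norm_mul]
      exact mul_le_of_le_one_right (norm_nonneg _) this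
    · have h1 := tendsto_pi_nhds.1 (HasOuterApproxClosed.tendsto_apprSeq hs) ζ
      have h2 := (((Complex.continuous_ofReal.comp NNReal.continuous_coe).tendsto _).comp
        h1).const_mul (f ζ)
      have e : s.indicator f ζ
          = f ζ * (Complex.ofReal ∘ NNReal.toReal) (s.indicator (fun _ => 1) ζ) := by
        by_cases hζ : ζ ∈ s <;> simp [hζ]
      rw [e]
      exact h2
  rw [← integral_indicator hs.measurableSet]
  refine tendsto_nhds_unique hlim (tendsto_const_nhds.congr fun m => ?_)
  refine (h ⟨fun ζ => ((hs.apprSeq m ζ : ℝ) : ℂ), ?_⟩).symm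
  have := (hs.apprSeq m).continuous
  fun_prop

/-- An integrable function on the torus all of whose Fourier coefficients vanish is zero. -/
theorem ae_eq_zero_of_integral_chi {f : Torus n → ℂ} (hf : Integrable f (torusHaar n))
    (h : ∀ k, ∫ ζ, f ζ * chi (-k) ζ ∂(torusHaar n) = 0) : f =ᵐ[torusHaar n] 0 :=
  ae_eq_zero_of_integral_mul_continuous hf
    (integral_mul_eq_zero_of_chi hf fun k => by simpa using h (-k))

end FourierUniqueness

section PoissonIntegral

open Filter Topology Set

/-! ### Fourier coefficients of Poisson integrals -/

variable {n : ℕ}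

/-- The kernel depends only on `ζ η⁻¹`: the Poisson integral is a convolution on the torus. -/
theorem poissonKernelAB_polar (α β : Fin n → ℂ) (r : Fin n → ℝ) (ζ η : Torus n) :
    poissonKernelAB α β (polar r ζ) η
      = ∏ j, discKernel (α j) (β j) ((r j : ℂ) * ((ζ * η⁻¹) j : Circle)) := by
  rw [poissonKernelAB_eq_prod]
  refine Finset.prod_congr rfl fun j _ => ?_
  rw [polar, Pi.mul_apply, Pi.inv_apply, Circle.coe_mul, Circle.coe_inv_eq_conj, mul_assoc]

theorem continuous_prod_discKernel (α β : Fin n → ℂ) {r : Fin n → ℝ} (hr : r ∈ unitBox n) :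
    Continuous fun ζ : Torus n => ∏ j, discKernel (α j) (β j) ((r j : ℂ) * (ζ j : Circle)) := by
  refine continuous_finsetProd _ fun j _ => ?_
  refine (continuousOn_discKernel (α j) (β j)).comp_continuous (by fun_prop) fun ζ => ?_
  exact norm_ofReal_mul_circle_lt (hr j) (ζ j)

theorem continuous_poissonKernelAB_polar (α β : Fin n → ℂ) {r : Fin n → ℝ} (hr : r ∈ unitBox n) :
    Continuous fun x : Torus n × Torus n => poissonKernelAB α β (polar r x.1) x.2 := by
  simp only [poissonKernelAB_polar]
  exact (continuous_prod_discKernel α β hr).comp (continuous_fst.mul continuous_snd.inv)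

theorem exists_poissonKernelAB_polar_le (α β : Fin n → ℂ) {r : Fin n → ℝ} (hr : r ∈ unitBox n) :
    ∃ C, ∀ ζ η : Torus n, ‖poissonKernelAB α β (polar r ζ) η‖ ≤ C := by
  obtain ⟨C, hC⟩ := isCompact_univ.exists_bound_of_continuousOn
    (continuous_poissonKernelAB_polar α β hr).continuousOn
  exact ⟨C, fun ζ η => hC (ζ, η) (mem_univ _)⟩

theorem continuous_poissonIntegralAB_polar (α β : Fin n → ℂ) {ψ : Torus n → ℂ}
    (hψ : Integrable ψ (torusHaar n)) {r : Fin n → ℝ} (hr : r ∈ unitBox n) :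
    Continuous fun ζ : Torus n => poissonIntegralAB α β ψ (polar r ζ) := by
  obtain ⟨C, hC⟩ := exists_poissonKernelAB_polar_le α β hr
  have hc := continuous_poissonKernelAB_polar α β hr
  refine continuous_of_dominated (bound := fun η => C * ‖ψ η‖) (fun ζ => ?_) (fun ζ => ?_)
    (hψ.norm.const_mul C) (.of_forall fun η => ?_)
  · exact (hc.comp (Continuous.prodMk_right ζ)).aestronglyMeasurable.mul hψ.aestronglyMeasurable
  · refine .of_forall fun η => ?_
    rw [norm_mul]
    gcongr
    exact hC ζ η
  · exact (hc.comp (Continuous.prodMk_left η)).mul continuous_const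

theorem integral_prod_discKernel_mul_chi (α β : Fin n → ℂ) (k : Fin n → ℤ) (r : Fin n → ℝ) :
    ∫ ζ : Torus n, (∏ j, discKernel (α j) (β j) ((r j : ℂ) * (ζ j : Circle))) * chi (-k) ζ
        ∂(torusHaar n)
      = ∏ j, radialCoeff (fun z => discKernel (α j) (β j) (z 0)) (k j) (r j) := by
  simp only [radialCoeff_comp_apply_zero]
  rw [← integral_fintype_prod_eq_prod (ι := Fin n) (𝕜 := ℂ)
    (fun j (ζ : Circle) => discKernel (α j) (β j) ((r j : ℂ) * (ζ : ℂ)) * (ζ : ℂ) ^ (-(k j)))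
    (μ := fun _ => circleHaar)]
  simp only [chi, ← Finset.prod_mul_distrib, Pi.neg_apply]
  rfl

/-- The convolution theorem, by Fubini and translation in `ζ`. -/
theorem coeff_poissonIntegralAB (α β : Fin n → ℂ) {ψ : Torus n → ℂ}
    (hψ : Integrable ψ (torusHaar n)) (k : Fin n → ℤ) {r : Fin n → ℝ} (hr : r ∈ unitBox n) :
    coeff (poissonIntegralAB α β ψ) k r
      = (∏ j, radialCoeff (fun z => discKernel (α j) (β j) (z 0)) (k j) (r j))
        * ∫ η, ψ η * chi (-k) η ∂(torusHaar n) := by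
  obtain ⟨C, hC⟩ := exists_poissonKernelAB_polar_le α β hr
  have hint : Integrable (Function.uncurry fun ζ η : Torus n =>
      poissonKernelAB α β (polar r ζ) η * ψ η * chi (-k) ζ) ((torusHaar n).prod (torusHaar n)) := by
    have h1 : Integrable (fun x : Torus n × Torus n => ψ x.2) ((torusHaar n).prod (torusHaar n)) :=
      hψ.comp_snd _
    have h2 : Continuous fun x : Torus n × Torus n =>
        poissonKernelAB α β (polar r x.1) x.2 * chi (-k) x.1 :=
      (continuous_poissonKernelAB_polar α β hr).mul ((continuous_chi _).comp continuous_fst)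
    refine (integrable_mul_continuous h1 h2).congr (.of_forall fun x => ?_)
    simp only [Function.uncurry]
    ring
  simp only [coeff, poissonIntegralAB, ← integral_mul_const]
  rw [integral_integral_swap hint, ← integral_const_mul]
  refine integral_congr_ae (.of_forall fun η => ?_)
  have h := integral_mul_chi_mul (fun ζ : Torus n =>
    ∏ j, discKernel (α j) (β j) ((r j : ℂ) * (ζ j : Circle))) k η⁻¹
  rw [integral_prod_discKernel_mul_chi] at h
  have hchi : chi k η⁻¹ = chi (-k) η := by
    simp [chi]
  simp only [poissonKernelAB_polar]
  calc ∫ ζ : Torus n, (∏ j, discKernel (α j) (β j) ((r j : ℂ) * ((ζ * η⁻¹) j : Circle))) * ψ η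
        * chi (-k) ζ ∂(torusHaar n)
      = ψ η * ∫ ζ : Torus n, (∏ j, discKernel (α j) (β j) ((r j : ℂ) * ((ζ * η⁻¹) j : Circle)))
        * chi (-k) ζ ∂(torusHaar n) := by
        rw [← integral_const_mul]
        exact integral_congr_ae (.of_forall fun ζ => by ring)
    _ = _ := by
        rw [h, hchi]
        ring

end PoissonIntegral

section WeakCompactness

open Filter Topology Set

/-! ### Weak compactness of bounded sets in `L^p` -/

variable {X : Type*} [MeasurableSpace X] {μ : Measure X}

/-- Hölder on `E`, giving uniform integrability once `p > 1`. For `p = ⊤` the convention `toReal =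
0` gives the correct exponent `1`. -/
theorem setLIntegral_le_mul_rpow {p : ℝ≥0∞} (hp : 1 ≤ p) {f : X → ℝ≥0∞} (hf : AEMeasurable f μ)
    {M : ℝ≥0∞} (hM : eLpNorm f p μ ≤ M) (E : Set X) :
    ∫⁻ x in E, f x ∂μ ≤ M * μ E ^ (1 - 1 / p.toReal) := by
  have h := eLpNorm_le_eLpNorm_mul_rpow_measure_univ (μ := μ.restrict E) hp
    hf.aestronglyMeasurable.restrict
  rw [eLpNorm_one_eq_lintegral_enorm] at h
  simp only [enorm_eq_self, Measure.restrict_apply_univ, ENNReal.toReal_one, one_div_one] at h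
  exact h.trans (by gcongr; exact (eLpNorm_restrict_le _ _ _ _).trans hM)

theorem one_sub_one_div_toReal_pos {p : ℝ≥0∞} (hp : 1 < p) : 0 < 1 - 1 / p.toReal := by
  rcases eq_or_ne p ⊤ with rfl | htop
  · simp
  · have : 1 < p.toReal := by
      rw [← ENNReal.toReal_one]
      exact (ENNReal.toReal_lt_toReal ENNReal.one_ne_top htop).2 hp
    have := (div_lt_one (by linarith)).2 this
    linarith

/-- The setwise limit of the measures `f_m μ` along an ultrafilter, for a bounded family in `L^p`,
is a measure. -/
theorem exists_measure_tendsto_setLIntegral [IsFiniteMeasure μ] {ι : Type*} (U : Ultrafilter ι)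
    {p : ℝ≥0∞} (hp : 1 < p) {f : ι → X → ℝ≥0∞} (hf : ∀ i, AEMeasurable (f i) μ) {M : ℝ≥0∞}
    (hMtop : M ≠ ⊤) (hM : ∀ i, eLpNorm (f i) p μ ≤ M) :
    ∃ ν : Measure X, (∀ E, MeasurableSet E → ν E ≤ M * μ E ^ (1 - 1 / p.toReal)) ∧
      ∀ E, MeasurableSet E → Tendsto (fun i => ∫⁻ x in E, f i x ∂μ) U (𝓝 (ν E)) := by
  -- `ℝ≥0∞` is compact, so every ultrafilter limit exists.
  have hlim : ∀ E : Set X, ∃ c, Tendsto (fun i => ∫⁻ x in E, f i x ∂μ) U (𝓝 c) := fun E =>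
    ⟨(U.map fun i => ∫⁻ x in E, f i x ∂μ).lim, (U.map fun i => ∫⁻ x in E, f i x ∂μ).le_nhds_lim⟩
  choose c hc using hlim
  have hθ := one_sub_one_div_toReal_pos hp
  have hbound : ∀ E, c E ≤ M * μ E ^ (1 - 1 / p.toReal) := fun E =>
    le_of_tendsto (hc E) (.of_forall fun i => setLIntegral_le_mul_rpow hp.le (hf i) (hM i) E)
  have hempty : c ∅ = 0 := by
    have := hbound ∅
    rw [measure_empty, ENNReal.zero_rpow_of_pos hθ, mul_zero] at this
    exact le_zero_iff.1 this
  have hunion : ∀ E F, MeasurableSet F → Disjoint E F → c (E ∪ F) = c E + c F := by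
    intro E F hF hd
    refine tendsto_nhds_unique ((hc (E ∪ F)).congr fun i => ?_) ((hc E).add (hc F))
    exact lintegral_union hF hd
  have hcount : ∀ ⦃E : ℕ → Set X⦄ (_ : ∀ i, MeasurableSet (E i)),
      Pairwise (Function.onFun Disjoint E) →
      c (⋃ i, E i) = ∑' i, c (E i) := by
    intro E hE hd
    -- Countable additivity follows from finite additivity, because the tails `T n` have `μ`-measure
    -- tending to zero and `hbound` then forces `c (T n)` to zero.
    let T : ℕ → Set X := fun n => ⋃ i, E (i + n)
    have hTm : ∀ n, MeasurableSet (T n) := fun n => MeasurableSet.iUnion fun i => hE _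
    have hTsucc : ∀ n, c (T n) = c (E n) + c (T (n + 1)) := by
      intro n
      rw [← hunion _ _ (hTm (n + 1))]
      · congr 1
        ext x
        simp only [T, mem_iUnion, mem_union]
        constructor
        · rintro ⟨i, hi⟩
          rcases i with _ | i
          · left; simpa using hi
          · right; exact ⟨i, by rwa [show i + (n + 1) = i + 1 + n by ring]⟩
        · rintro (h | ⟨i, hi⟩)
          · exact ⟨0, by simpa using h⟩
          · exact ⟨i + 1, by rwa [show i + 1 + n = i + (n + 1) by ring]⟩
      · rw [disjoint_iUnion_right]
        exact fun i => hd (by omega)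
    have hpart : ∀ n, ∑ i ∈ Finset.range n, c (E i) + c (T n) = c (⋃ i, E i) := by
      intro n
      induction n with
      | zero => simp [T]
      | succ n ih => rw [Finset.sum_range_succ, add_assoc, ← hTsucc, ih]
    have hμT : Tendsto (fun n => μ (T n)) atTop (𝓝 0) := by
      have h1 : ∀ n, μ (T n) = ∑' i, μ (E (i + n)) := fun n =>
        measure_iUnion (fun i j hij => hd (by omega)) fun i => hE _
      simp only [h1]
      refine ENNReal.tendsto_sum_nat_add (fun i => μ (E i)) ?_
      rw [← measure_iUnion hd hE]
      exact measure_ne_top _ _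
    have hcT : Tendsto (fun n => c (T n)) atTop (𝓝 0) := by
      have h2 : Tendsto (fun n => M * μ (T n) ^ (1 - 1 / p.toReal)) atTop (𝓝 0) := by
        have := ENNReal.Tendsto.const_mul (a := M)
          ((ENNReal.continuous_rpow_const (y := 1 - 1 / p.toReal)).tendsto 0 |>.comp hμT)
          (Or.inr hMtop)
        rwa [ENNReal.zero_rpow_of_pos hθ, mul_zero] at this
      exact tendsto_of_tendsto_of_tendsto_of_le_of_le tendsto_const_nhds h2
        (fun _ => zero_le) fun n => hbound _
    have hsum := (ENNReal.tendsto_nat_tsum fun i => c (E i)).add hcT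
    simp only [hpart, add_zero] at hsum
    exact tendsto_nhds_unique tendsto_const_nhds hsum
  refine ⟨Measure.ofMeasurable (fun E _ => c E) hempty hcount, fun E hE => ?_, fun E hE => ?_⟩
  · rw [Measure.ofMeasurable_apply E hE]
    exact hbound E
  · rw [Measure.ofMeasurable_apply E hE]
    exact hc E

theorem tendsto_lintegral_simpleFunc {ι : Type*} {l : Filter ι} {ν : ι → Measure X}
    {ν₀ : Measure X} (h : ∀ E, MeasurableSet E → Tendsto (fun i => ν i E) l (𝓝 (ν₀ E)))
    (s : SimpleFunc X NNReal) :
    Tendsto (fun i => ∫⁻ x, s x ∂(ν i)) l (𝓝 (∫⁻ x, s x ∂ν₀)) := by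
  have e : ∀ ν : Measure X, ∫⁻ x, s x ∂ν = ∑ y ∈ s.range, (y : ℝ≥0∞) * ν (s ⁻¹' {y}) := by
    intro ν
    have h1 : ∫⁻ x, s x ∂ν = ∫⁻ x, (s.map ((↑) : NNReal → ℝ≥0∞)) x ∂ν := rfl
    rw [h1, SimpleFunc.lintegral_eq_lintegral, SimpleFunc.map_lintegral]
  simp only [e]
  exact tendsto_finsetSum _ fun y _ =>
    ENNReal.Tendsto.const_mul (h _ (s.measurableSet_preimage _)) (Or.inr ENNReal.coe_ne_top)

/-- The converse of Hölder's inequality. For simple `φ ≤ g^p`, with `s = φ^{1/p}`, testing against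
`t = s^{p-1}` bounds `I = ∫ φ` by `M I^{1/q}`; as `I` is finite, this can be divided out. -/
theorem lintegral_rpow_le_of_simpleFunc [IsFiniteMeasure μ] {p q : ℝ} (hpq : p.HolderConjugate q)
    {g : X → ℝ≥0∞} {M : ℝ≥0∞}
    (h : ∀ t : SimpleFunc X NNReal,
      ∫⁻ x, g x * t x ∂μ ≤ M * (∫⁻ x, (t x : ℝ≥0∞) ^ q ∂μ) ^ (1 / q)) :
    (∫⁻ x, g x ^ p ∂μ) ^ (1 / p) ≤ M := by
  have hp0 := hpq.pos
  have hp1 : 0 < p - 1 := hpq.sub_one_pos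
  suffices hI : ∫⁻ x, g x ^ p ∂μ ≤ M ^ p by
    rw [one_div, ENNReal.rpow_inv_le_iff hp0]
    exact hI
  rw [lintegral_eq_nnreal]
  refine iSup₂_le fun φ hφ => ?_
  let s : SimpleFunc X NNReal := φ.map fun y => y ^ (1 / p)
  let t : SimpleFunc X NNReal := s.map fun y => y ^ (p - 1)
  have hs : ∀ x, (s x : ℝ≥0∞) ^ p = φ x := fun x => by
    rw [SimpleFunc.map_apply, ← ENNReal.coe_rpow_of_nonneg _ hp0.le, ← NNReal.rpow_mul,
      one_div_mul_cancel hp0.ne', NNReal.rpow_one]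
  have hsg : ∀ x, (s x : ℝ≥0∞) ≤ g x := fun x => by
    have := hφ x
    rw [← hs x] at this
    exact (ENNReal.rpow_le_rpow_iff hp0).1 this
  have ht : ∀ x, (t x : ℝ≥0∞) = (s x : ℝ≥0∞) ^ (p - 1) := fun x => by
    rw [SimpleFunc.map_apply, ENNReal.coe_rpow_of_nonneg _ hp1.le]
  have hst : ∀ x, (s x : ℝ≥0∞) * t x = φ x := fun x => by
    rw [ht, ← hs x]
    nth_rw 1 [← ENNReal.rpow_one (s x : ℝ≥0∞)]
    rw [← ENNReal.rpow_add_of_nonneg _ _ zero_le_one hp1.le, add_sub_cancel]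
  have htq : ∀ x, (t x : ℝ≥0∞) ^ q = φ x := fun x => by
    rw [ht, ← ENNReal.rpow_mul, hpq.sub_one_mul_conj, hs]
  have hI : (φ.map ((↑) : NNReal → ℝ≥0∞)).lintegral μ = ∫⁻ x, φ x ∂μ := by
    rw [← SimpleFunc.lintegral_eq_lintegral]; rfl
  rw [hI]
  set I := ∫⁻ x, (φ x : ℝ≥0∞) ∂μ with hIdef
  have hItop : I ≠ ⊤ := by
    rw [← hI, SimpleFunc.map_lintegral]
    refine (ENNReal.sum_lt_top.2 fun y _ => ?_).ne
    exact ENNReal.mul_lt_top ENNReal.coe_lt_top (measure_lt_top _ _)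
  have hle : I ≤ M * I ^ (1 / q) := by
    have h1 := h t
    simp only [htq] at h1
    refine le_trans (lintegral_mono fun x => ?_) h1
    rw [← hst x]
    gcongr
    exact hsg x
  rcases eq_or_ne I 0 with h0 | h0
  · rw [h0]; exact zero_le
  · have hq0 : I ^ (1 / q) ≠ 0 := by simp [ENNReal.rpow_eq_zero_iff, h0, hItop]
    have hqt : I ^ (1 / q) ≠ ⊤ := ENNReal.rpow_ne_top_of_nonneg
      (by have := hpq.symm.pos; positivity) hItop
    have hsplit : I = I ^ (1 / p) * I ^ (1 / q) := by
      rw [← ENNReal.rpow_add _ _ h0 hItop, one_div, one_div, hpq.inv_add_inv_eq_one,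
        ENNReal.rpow_one]
    have h2 : I ^ (1 / p) ≤ M := by
      nth_rw 1 [hsplit] at hle
      exact (ENNReal.mul_le_mul_iff_left hq0 hqt).1 hle
    rw [one_div, ENNReal.rpow_inv_le_iff hp0] at h2
    exact h2

/-- The bound on the limit measure makes it absolutely continuous, and `g` is its density. The norm
bound for `p = ⊤` is the setwise bound; for finite `p`, Hölder's inequality passes to the limit
against simple functions. -/
theorem exists_tendsto_setLIntegral [IsFiniteMeasure μ] {ι : Type*} (U : Ultrafilter ι)
    {p : ℝ≥0∞} (hp : 1 < p) {f : ι → X → ℝ≥0∞} (hf : ∀ i, AEMeasurable (f i) μ) {M : ℝ≥0∞}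
    (hMtop : M ≠ ⊤) (hM : ∀ i, eLpNorm (f i) p μ ≤ M) :
    ∃ g : X → ℝ≥0∞, Measurable g ∧ eLpNorm g p μ ≤ M ∧ (∫⁻ x, g x ∂μ ≠ ⊤) ∧
      ∀ E, MeasurableSet E → Tendsto (fun i => ∫⁻ x in E, f i x ∂μ) U (𝓝 (∫⁻ x in E, g x ∂μ)) := by
  obtain ⟨ν, hν, hlim⟩ := exists_measure_tendsto_setLIntegral U hp hf hMtop hM
  have hθ := one_sub_one_div_toReal_pos hp
  have hac : ν ≪ μ := by
    refine Measure.AbsolutelyContinuous.mk fun E hE h0 => ?_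
    have := hν E hE
    rw [h0, ENNReal.zero_rpow_of_pos hθ, mul_zero] at this
    exact le_zero_iff.1 this
  have hfin : IsFiniteMeasure ν := ⟨(hν univ .univ).trans_lt
    (ENNReal.mul_lt_top hMtop.lt_top
      (ENNReal.rpow_lt_top_of_nonneg hθ.le (measure_ne_top _ _)))⟩
  have hg := Measure.measurable_rnDeriv ν μ
  have hνg : μ.withDensity (ν.rnDeriv μ) = ν := Measure.withDensity_rnDeriv_eq ν μ hac
  have hset : ∀ E, MeasurableSet E → ∫⁻ x in E, ν.rnDeriv μ x ∂μ = ν E := fun E hE => by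
    rw [← withDensity_apply _ hE, hνg]
  refine ⟨ν.rnDeriv μ, hg, ?_, ?_, fun E hE => ?_⟩
  · rcases eq_or_ne p ⊤ with rfl | htop
    · rw [eLpNorm_exponent_top]
      have hae : ν.rnDeriv μ ≤ᵐ[μ] fun _ => M := by
        refine ae_le_of_forall_setLIntegral_le_of_sigmaFinite hg fun E hE _ => ?_
        rw [hset E hE]
        simpa using hν E hE
      refine eLpNormEssSup_le_of_ae_enorm_bound ?_
      filter_upwards [hae] with x hx using hx
    · have hp1 : 1 < p.toReal := by
        rw [← ENNReal.toReal_one]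
        exact (ENNReal.toReal_lt_toReal ENNReal.one_ne_top htop).2 hp
      have hpq := Real.HolderConjugate.conjExponent hp1
      have hp0 : p ≠ 0 := (zero_lt_one.trans hp).ne'
      rw [eLpNorm_eq_lintegral_rpow_enorm_toReal hp0 htop]
      simp only [enorm_eq_self]
      refine lintegral_rpow_le_of_simpleFunc hpq fun t => ?_
      have htm : Measurable fun x => (t x : ℝ≥0∞) := t.measurable.coe_nnreal_ennreal
      have hdens := tendsto_lintegral_simpleFunc (l := (U : Filter ι))
        (ν := fun i => μ.withDensity (f i)) (ν₀ := ν)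
        (fun E hE => by simpa only [withDensity_apply _ hE] using hlim E hE) t
      have e2 : ∫⁻ x, t x ∂ν = ∫⁻ x, ν.rnDeriv μ x * t x ∂μ := by
        nth_rw 1 [← hνg]
        rw [lintegral_withDensity_eq_lintegral_mul _ hg htm]
        rfl
      rw [← e2]
      refine le_of_tendsto hdens (.of_forall fun i => ?_)
      rw [lintegral_withDensity_eq_lintegral_mul₀ (hf i) htm.aemeasurable]
      refine (ENNReal.lintegral_mul_le_Lp_mul_Lq μ hpq (hf i) htm.aemeasurable).trans ?_
      gcongr
      have := hM i
      rw [eLpNorm_eq_lintegral_rpow_enorm_toReal hp0 htop] at this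
      simpa using this
  · have := hset univ .univ
    rw [Measure.restrict_univ] at this
    rw [this]
    exact measure_ne_top _ _
  · rw [hset E hE]
    exact hlim E hE

theorem exists_tendsto_setIntegral_real [IsFiniteMeasure μ] {ι : Type*} (U : Ultrafilter ι)
    {p : ℝ≥0∞} (hp : 1 < p) {f : ι → X → ℝ} (hf : ∀ i, AEStronglyMeasurable (f i) μ) {M : ℝ≥0∞}
    (hMtop : M ≠ ⊤) (hM : ∀ i, eLpNorm (f i) p μ ≤ M) :
    ∃ g : X → ℝ, MemLp g p μ ∧
      ∀ E, MeasurableSet E → Tendsto (fun i => ∫ x in E, f i x ∂μ) U (𝓝 (∫ x in E, g x ∂μ)) := by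
  have hint : ∀ i, Integrable (f i) μ := fun i =>
    MemLp.integrable hp.le ⟨hf i, (hM i).trans_lt hMtop.lt_top⟩
  have hpos : ∀ i, eLpNorm (fun x => ENNReal.ofReal (f i x)) p μ ≤ M := fun i =>
    (eLpNorm_mono_enorm fun x => by
      rw [enorm_eq_self, Real.enorm_eq_ofReal_abs]
      exact ENNReal.ofReal_le_ofReal (le_abs_self _)).trans (hM i)
  have hneg : ∀ i, eLpNorm (fun x => ENNReal.ofReal (-f i x)) p μ ≤ M := fun i =>
    (eLpNorm_mono_enorm fun x => by
      rw [enorm_eq_self, Real.enorm_eq_ofReal_abs]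
      exact ENNReal.ofReal_le_ofReal (neg_le_abs _)).trans (hM i)
  obtain ⟨g₁, hg₁, hn₁, ht₁, hl₁⟩ := exists_tendsto_setLIntegral U hp
    (fun i => (hf i).aemeasurable.ennreal_ofReal) hMtop hpos
  obtain ⟨g₂, hg₂, hn₂, ht₂, hl₂⟩ := exists_tendsto_setLIntegral U hp
    (fun i => (hf i).aemeasurable.neg.ennreal_ofReal) hMtop hneg
  have hmem : ∀ {g : X → ℝ≥0∞}, Measurable g → eLpNorm g p μ ≤ M →
      MemLp (fun x => (g x).toReal) p μ := fun {g} hg hn =>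
    ⟨hg.ennreal_toReal.aestronglyMeasurable, ((eLpNorm_mono_enorm fun x => by
      rw [Real.enorm_eq_ofReal ENNReal.toReal_nonneg, enorm_eq_self]
      exact ENNReal.ofReal_toReal_le).trans hn).trans_lt hMtop.lt_top⟩
  have hset : ∀ {g : X → ℝ≥0∞}, Measurable g → ∫⁻ x, g x ∂μ ≠ ⊤ → ∀ E,
      ∫ x in E, (g x).toReal ∂μ = (∫⁻ x in E, g x ∂μ).toReal := fun {g} hg ht E =>
    integral_toReal hg.aemeasurable (ae_restrict_of_ae (ae_lt_top hg ht))
  refine ⟨fun x => (g₁ x).toReal - (g₂ x).toReal, (hmem hg₁ hn₁).sub (hmem hg₂ hn₂),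
    fun E hE => ?_⟩
  rw [integral_sub ((hmem hg₁ hn₁).integrable hp.le).integrableOn
    ((hmem hg₂ hn₂).integrable hp.le).integrableOn, hset hg₁ ht₁, hset hg₂ ht₂]
  have hfin : ∀ {g : X → ℝ≥0∞}, ∫⁻ x, g x ∂μ ≠ ⊤ → ∫⁻ x in E, g x ∂μ ≠ ⊤ := fun ht =>
    ((setLIntegral_le_lintegral _ _).trans_lt ht.lt_top).ne
  refine (((ENNReal.tendsto_toReal (hfin ht₁)).comp (hl₁ E hE)).sub
    ((ENNReal.tendsto_toReal (hfin ht₂)).comp (hl₂ E hE))).congr fun i => ?_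
  exact (integral_eq_lintegral_pos_part_sub_lintegral_neg_part (hint i).integrableOn).symm

theorem integral_ofReal_add_ofReal_mul_I {g₁ g₂ : X → ℝ} (h₁ : Integrable g₁ μ)
    (h₂ : Integrable g₂ μ) : ∫ x, ((g₁ x : ℂ) + g₂ x * Complex.I) ∂μ
      = ((∫ x, g₁ x ∂μ : ℝ) : ℂ) + ((∫ x, g₂ x ∂μ : ℝ) : ℂ) * Complex.I := by
  have i₁ : Integrable (fun x => (g₁ x : ℂ)) μ := h₁.ofReal
  have i₂ : Integrable (fun x => (g₂ x : ℂ)) μ := h₂.ofReal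
  rw [integral_add i₁ (i₂.mul_const _), integral_mul_const, integral_complex_ofReal,
    integral_complex_ofReal]

theorem integral_eq_re_add_im_mul_I {f : X → ℂ} (hf : Integrable f μ) : ∫ x, f x ∂μ
      = ((∫ x, (f x).re ∂μ : ℝ) : ℂ) + ((∫ x, (f x).im ∂μ : ℝ) : ℂ) * Complex.I := by
  have h₁ : Integrable (fun x => (f x).re) μ := hf.re
  have h₂ : Integrable (fun x => (f x).im) μ := hf.im
  rw [← integral_ofReal_add_ofReal_mul_I h₁ h₂]
  exact integral_congr_ae (.of_forall fun x => (Complex.re_add_im (f x)).symm)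

theorem exists_tendsto_setIntegral_complex [IsFiniteMeasure μ] {ι : Type*} (U : Ultrafilter ι)
    {p : ℝ≥0∞} (hp : 1 < p) {f : ι → X → ℂ} (hf : ∀ i, AEStronglyMeasurable (f i) μ) {M : ℝ≥0∞}
    (hMtop : M ≠ ⊤) (hM : ∀ i, eLpNorm (f i) p μ ≤ M) :
    ∃ g : X → ℂ, MemLp g p μ ∧
      ∀ E, MeasurableSet E → Tendsto (fun i => ∫ x in E, f i x ∂μ) U (𝓝 (∫ x in E, g x ∂μ)) := by
  have hint : ∀ i, Integrable (f i) μ := fun i =>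
    MemLp.integrable hp.le ⟨hf i, (hM i).trans_lt hMtop.lt_top⟩
  have hre : ∀ i, eLpNorm (fun x => (f i x).re) p μ ≤ M := fun i =>
    (eLpNorm_mono fun x => Complex.abs_re_le_norm _).trans (hM i)
  have him : ∀ i, eLpNorm (fun x => (f i x).im) p μ ≤ M := fun i =>
    (eLpNorm_mono fun x => Complex.abs_im_le_norm _).trans (hM i)
  obtain ⟨g₁, hg₁, hl₁⟩ := exists_tendsto_setIntegral_real U hp (f := fun i x => (f i x).re)
    (fun i => Complex.continuous_re.comp_aestronglyMeasurable (hf i)) hMtop hre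
  obtain ⟨g₂, hg₂, hl₂⟩ := exists_tendsto_setIntegral_real U hp (f := fun i x => (f i x).im)
    (fun i => Complex.continuous_im.comp_aestronglyMeasurable (hf i)) hMtop him
  have m₁ : MemLp (fun x => (g₁ x : ℂ)) p μ := hg₁.ofReal
  have m₂ : MemLp (fun x => (g₂ x : ℂ)) p μ := hg₂.ofReal
  have m₃ : MemLp (fun x => (g₁ x : ℂ) + g₂ x * Complex.I) p μ :=
    m₁.add (m₂.mul_const Complex.I)
  refine ⟨_, m₃, fun E hE => ?_⟩
  have l₁ : Tendsto (fun i => ((∫ x in E, (f i x).re ∂μ : ℝ) : ℂ)) U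
      (𝓝 ((∫ x in E, g₁ x ∂μ : ℝ) : ℂ)) :=
    (Complex.continuous_ofReal.tendsto _).comp (hl₁ E hE)
  have l₂ : Tendsto (fun i => ((∫ x in E, (f i x).im ∂μ : ℝ) : ℂ)) U
      (𝓝 ((∫ x in E, g₂ x ∂μ : ℝ) : ℂ)) :=
    (Complex.continuous_ofReal.tendsto _).comp (hl₂ E hE)
  have l₃ := l₁.add (l₂.mul_const Complex.I)
  rw [← integral_ofReal_add_ofReal_mul_I (hg₁.integrable hp.le).integrableOn
    (hg₂.integrable hp.le).integrableOn] at l₃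
  exact l₃.congr fun i => (integral_eq_re_add_im_mul_I (hint i).integrableOn).symm

theorem exists_simpleFunc_norm_sub_le [TopologicalSpace X] [CompactSpace X] [BorelSpace X]
    {φ : X → ℂ} (hφ : Continuous φ) {ε : ℝ} (hε : 0 < ε) :
    ∃ s : SimpleFunc X ℂ, ∀ x, ‖φ x - s x‖ ≤ ε := by
  let e := TopologicalSpace.denseSeq ℂ
  obtain ⟨t, ht⟩ := isCompact_univ.elim_finite_subcover (fun k => φ ⁻¹' Metric.ball (e k) ε)
    (fun k => Metric.isOpen_ball.preimage hφ) (fun x _ => by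
      obtain ⟨k, hk⟩ := (TopologicalSpace.denseRange_denseSeq ℂ).exists_dist_lt (φ x) hε
      exact mem_iUnion.2 ⟨k, hk⟩)
  refine ⟨(SimpleFunc.nearestPt e (t.sup id)).comp φ hφ.measurable, fun x => ?_⟩
  obtain ⟨k, hk, hxk⟩ := mem_iUnion₂.1 (ht (mem_univ x))
  have h1 := SimpleFunc.edist_nearestPt_le e (φ x) (Finset.le_sup (f := id) hk)
  rw [edist_dist, edist_dist, ENNReal.ofReal_le_ofReal_iff dist_nonneg] at h1
  rw [← dist_eq_norm, dist_comm]
  exact h1.trans (by rw [dist_comm]; exact (Metric.mem_ball.1 hxk).le)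

theorem integral_mul_simpleFunc {f : X → ℂ} (hf : Integrable f μ) (s : SimpleFunc X ℂ) :
    ∫ x, f x * s x ∂μ = ∑ y ∈ s.range, y * ∫ x in s ⁻¹' {y}, f x ∂μ := by
  have e : ∀ x, f x * s x = ∑ y ∈ s.range, y * (s ⁻¹' {y}).indicator f x := by
    intro x
    rw [Finset.sum_eq_single (s x)]
    · simp [mul_comm]
    · intro y _ hy
      rw [indicator_of_notMem (by simpa using hy.symm), mul_zero]
    · simp
  simp only [e]
  rw [integral_finsetSum _ fun y _ =>
    (hf.indicator (s.measurableSet_preimage _)).const_mul y]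
  refine Finset.sum_congr rfl fun y _ => ?_
  rw [integral_const_mul, integral_indicator (s.measurableSet_preimage _)]

/-- A bounded family in `L^p`, `1 < p ≤ ∞`, converges along an ultrafilter when tested against
continuous functions. -/
theorem exists_tendsto_integral_mul_continuous [TopologicalSpace X] [CompactSpace X] [BorelSpace X]
    [IsProbabilityMeasure μ] {ι : Type*} (U : Ultrafilter ι)
    {p : ℝ≥0∞} (hp : 1 < p) {f : ι → X → ℂ} (hf : ∀ i, AEStronglyMeasurable (f i) μ) {M : ℝ≥0∞}
    (hMtop : M ≠ ⊤) (hM : ∀ i, eLpNorm (f i) p μ ≤ M) :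
    ∃ g : X → ℂ, MemLp g p μ ∧ ∀ φ : X → ℂ, Continuous φ →
      Tendsto (fun i => ∫ x, f i x * φ x ∂μ) U (𝓝 (∫ x, g x * φ x ∂μ)) := by
  obtain ⟨g, hg, hlim⟩ := exists_tendsto_setIntegral_complex U hp hf hMtop hM
  refine ⟨g, hg, fun φ hφ => ?_⟩
  have hgi : Integrable g μ := hg.integrable hp.le
  have hint : ∀ i, Integrable (f i) μ := fun i =>
    MemLp.integrable hp.le ⟨hf i, (hM i).trans_lt hMtop.lt_top⟩
  have hnorm : ∀ i, ∫ x, ‖f i x‖ ∂μ ≤ M.toReal := fun i => by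
    rw [integral_norm_eq_lintegral_enorm (hf i), ← eLpNorm_one_eq_lintegral_enorm]
    exact ENNReal.toReal_mono hMtop ((eLpNorm_le_eLpNorm_of_exponent_le hp.le (hf i)).trans (hM i))
  have happrox : ∀ {h : X → ℂ}, Integrable h μ → ∀ {ε : ℝ} (s : SimpleFunc X ℂ),
      (∀ x, ‖φ x - s x‖ ≤ ε) →
      ‖∫ x, h x * φ x ∂μ - ∫ x, h x * s x ∂μ‖ ≤ ε * ∫ x, ‖h x‖ ∂μ := by
    intro h hh ε s hs
    obtain ⟨C, hC⟩ := s.exists_forall_norm_le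
    rw [← integral_sub (integrable_mul_continuous hh hφ)
      (hh.mul_bdd (c := C) s.stronglyMeasurable.aestronglyMeasurable (.of_forall hC)),
      ← integral_const_mul]
    refine norm_integral_le_of_norm_le (hh.norm.const_mul _) (.of_forall fun x => ?_)
    rw [← mul_sub, norm_mul, mul_comm]
    exact mul_le_mul_of_nonneg_right (hs x) (norm_nonneg _)
  rw [Metric.tendsto_nhds]
  intro ε hε
  -- The `+ 1` makes `K` positive and keeps the two approximation errors strictly below `ε / 2`.
  set K := M.toReal + ∫ x, ‖g x‖ ∂μ + 1
  have hgn : 0 ≤ ∫ x, ‖g x‖ ∂μ := integral_nonneg fun _ => norm_nonneg _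
  have hMn : 0 ≤ M.toReal := ENNReal.toReal_nonneg
  have hK : 0 < K := by positivity
  have hδ : 0 < ε / (2 * K) := by positivity
  obtain ⟨s, hs⟩ := exists_simpleFunc_norm_sub_le hφ hδ
  have hsimple : Tendsto (fun i => ∫ x, f i x * s x ∂μ) U (𝓝 (∫ x, g x * s x ∂μ)) := by
    simp only [integral_mul_simpleFunc (hint _), integral_mul_simpleFunc hgi]
    exact tendsto_finsetSum _ fun y _ => (hlim _ (s.measurableSet_preimage _)).const_mul y
  filter_upwards [(Metric.tendsto_nhds.1 hsimple) (ε / 2) (by positivity)] with i hi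
  have h1 := happrox (hint i) s hs
  have h2 := happrox hgi s hs
  rw [dist_eq_norm] at hi ⊢
  have h3 : ε / (2 * K) * ∫ x, ‖f i x‖ ∂μ ≤ ε / (2 * K) * M.toReal := by gcongr; exact hnorm i
  have h4 : ε / (2 * K) * M.toReal + ε / (2 * K) * ∫ x, ‖g x‖ ∂μ < ε / 2 := by
    rw [← mul_add]
    calc ε / (2 * K) * (M.toReal + ∫ x, ‖g x‖ ∂μ) < ε / (2 * K) * K := by gcongr; simp [K]
      _ = ε / 2 := by field_simp
  calc ‖∫ x, f i x * φ x ∂μ - ∫ x, g x * φ x ∂μ‖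
      = ‖(∫ x, f i x * φ x ∂μ - ∫ x, f i x * s x ∂μ)
        + (∫ x, f i x * s x ∂μ - ∫ x, g x * s x ∂μ)
        - (∫ x, g x * φ x ∂μ - ∫ x, g x * s x ∂μ)‖ := by congr 1; ring
    _ ≤ _ := (norm_sub_le _ _).trans (add_le_add_left (norm_add_le _ _) _)
    _ < ε := by linarith

end WeakCompactness

section Representation

open Filter Topology Set

/-! ### Representation by Poisson integrals -/

variable {n : ℕ}

theorem exists_polar_eq {z : Fin n → ℂ} (hz : z ∈ polydisc n) :
    ∃ (r : Fin n → ℝ) (ζ : Torus n), (∀ j, r j ∈ Ico (0 : ℝ) 1) ∧ polar r ζ = z := by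
  refine ⟨fun j => ‖z j‖, fun j => Circle.exp (z j).arg, fun j => ⟨norm_nonneg _, hz j⟩, ?_⟩
  funext j
  simp [polar, Circle.coe_exp]

theorem mem_unitBox_of_Ico {r : Fin n → ℝ} (hr : ∀ j, r j ∈ Ico (0 : ℝ) 1) : r ∈ unitBox n :=
  fun j => by
    rw [abs_of_nonneg (hr j).1]
    exact (hr j).2

/-- Two functions with continuous slices and the same Fourier coefficients on all polydisc radii
agree on the polydisc. -/
theorem eqOn_polydisc_of_coeff_eq {u v : (Fin n → ℂ) → ℂ}
    (hu : ∀ r ∈ unitBox n, Continuous fun ζ : Torus n => u (polar r ζ))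
    (hv : ∀ r ∈ unitBox n, Continuous fun ζ : Torus n => v (polar r ζ))
    (h : ∀ k (r : Fin n → ℝ), (∀ j, r j ∈ Ico (0 : ℝ) 1) → coeff u k r = coeff v k r) :
    EqOn u v (polydisc n) := by
  intro z hz
  obtain ⟨r, ζ, hr, rfl⟩ := exists_polar_eq hz
  have hcu := hu r (mem_unitBox_of_Ico hr)
  have hcv := hv r (mem_unitBox_of_Ico hr)
  have hae := ae_eq_zero_of_integral_chi
    (f := fun ζ => u (polar r ζ) - v (polar r ζ))
    (integrable_of_continuous (hcu.sub hcv)) fun k => by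
      simp only [sub_mul]
      refine (integral_sub (integrable_of_continuous (hcu.mul (continuous_chi _)))
        (integrable_of_continuous (hcv.mul (continuous_chi _)))).trans (sub_eq_zero.2 ?_)
      exact h k r hr
  -- Haar measure charges nonempty open sets, so continuous functions equal almost everywhere are
  -- equal.
  have heq := (hcu.sub hcv).ae_eq_iff_eq (torusHaar n) continuous_zero |>.1 hae
  exact sub_eq_zero.1 (congrFun heq ζ)

variable {α β : Fin n → ℂ}

theorem tendsto_prod_radialCoeff (hre : ∀ j, -1 < (α j).re + (β j).re)
    (hα : ∀ j, ∀ k : ℕ, α j ≠ -((k : ℂ) + 1)) (hβ : ∀ j, ∀ k : ℕ, β j ≠ -((k : ℂ) + 1))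
    (k : Fin n → ℤ) :
    Tendsto (fun t => ∏ j, radialCoeff (fun z => discKernel (α j) (β j) (z 0)) (k j) t)
      (𝓝[<] 1) (𝓝 1) := by
  simpa using tendsto_finsetProd Finset.univ fun j _ =>
    tendsto_radialCoeff_discKernel (hre j) (hα j) (hβ j) (k j)

/-- The Fourier coefficients of a function are recovered from its Poisson integral. -/
theorem tendsto_coeff_poissonIntegralAB (hre : ∀ j, -1 < (α j).re + (β j).re)
    (hα : ∀ j, ∀ k : ℕ, α j ≠ -((k : ℂ) + 1)) (hβ : ∀ j, ∀ k : ℕ, β j ≠ -((k : ℂ) + 1))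
    {ψ : Torus n → ℂ} (hψ : Integrable ψ (torusHaar n)) (k : Fin n → ℤ) :
    Tendsto (fun t => coeff (poissonIntegralAB α β ψ) k fun _ => t) (𝓝[<] 1)
      (𝓝 (∫ η, ψ η * chi (-k) η ∂(torusHaar n))) := by
  have h := (tendsto_prod_radialCoeff hre hα hβ k).mul_const (∫ η, ψ η * chi (-k) η ∂(torusHaar n))
  rw [one_mul] at h
  refine h.congr' ?_
  filter_upwards [Ioo_mem_nhdsLT (show (0 : ℝ) < 1 by simp)] with t ht
  exact (coeff_poissonIntegralAB α β hψ k
    (mem_unitBox_of_Ico (r := fun _ => t) fun _ => ⟨ht.1.le, ht.2⟩)).symm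

/-- The Fourier coefficients of the boundary function are radial limits of those of its Poisson
integral. -/
theorem poissonIntegralAB_injective (hre : ∀ j, -1 < (α j).re + (β j).re)
    (hα : ∀ j, ∀ k : ℕ, α j ≠ -((k : ℂ) + 1)) (hβ : ∀ j, ∀ k : ℕ, β j ≠ -((k : ℂ) + 1))
    {ψ φ : Torus n → ℂ} (hψ : Integrable ψ (torusHaar n)) (hφ : Integrable φ (torusHaar n))
    (h : ∀ z ∈ polydisc n, poissonIntegralAB α β ψ z = poissonIntegralAB α β φ z) :
    ψ =ᵐ[torusHaar n] φ := by
  have hzero := ae_eq_zero_of_integral_chi (hψ.sub hφ) fun k => by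
    simp only [Pi.sub_apply, sub_mul]
    rw [integral_sub (integrable_mul_continuous hψ (continuous_chi _))
      (integrable_mul_continuous hφ (continuous_chi _)), sub_eq_zero]
    refine tendsto_nhds_unique (tendsto_coeff_poissonIntegralAB hre hα hβ hψ k)
      ((tendsto_coeff_poissonIntegralAB hre hα hβ hφ k).congr' ?_)
    filter_upwards [Ioo_mem_nhdsLT (show (0 : ℝ) < 1 by simp)] with t ht
    refine integral_congr_ae (.of_forall fun ζ => ?_)
    simp only
    rw [h _ (polar_mem (mem_unitBox_of_Ico (r := fun _ => t) fun _ => ⟨ht.1.le, ht.2⟩) ζ)]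
  filter_upwards [hzero] with ζ hζ using sub_eq_zero.1 hζ

theorem poissonIntegralAB_congr_ae {ψ φ : Torus n → ℂ} (h : ψ =ᵐ[torusHaar n] φ) :
    poissonIntegralAB α β ψ = poissonIntegralAB α β φ := by
  funext z
  refine integral_congr_ae ?_
  filter_upwards [h] with ζ hζ
  rw [hζ]

theorem exists_memLp_eq_poissonIntegralAB (hre : ∀ j, -1 < (α j).re + (β j).re)
    (hα : ∀ j, ∀ k : ℕ, α j ≠ -((k : ℂ) + 1)) (hβ : ∀ j, ∀ k : ℕ, β j ≠ -((k : ℂ) + 1))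
    {p : ℝ≥0∞} (hp : 1 < p) {u : (Fin n → ℂ) → ℂ} (hu : IsSepHarmonic α β u)
    (hbdd : (⨆ r ∈ Set.Ico (0 : ℝ) 1, eLpNorm (dilate u r) p (torusHaar n)) < ⊤) :
    ∃ ψ : Torus n → ℂ, MemLp ψ p (torusHaar n) ∧
      ∀ z ∈ polydisc n, u z = poissonIntegralAB α β ψ z := by
  obtain ⟨R, hRlim, hR⟩ : ∃ R : ℕ → ℝ, Tendsto R atTop (𝓝[<] 1) ∧ ∀ m, R m ∈ Ico (0 : ℝ) 1 := by
    obtain ⟨R, -, hR, hlim⟩ := exists_seq_strictMono_tendsto' (show (0 : ℝ) < 1 by simp)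
    exact ⟨R, tendsto_nhdsWithin_iff.2 ⟨hlim, .of_forall fun m => (hR m).2⟩,
      fun m => ⟨(hR m).1.le, (hR m).2⟩⟩
  have hbox : ∀ m, (fun _ => R m : Fin n → ℝ) ∈ unitBox n := fun m =>
    mem_unitBox_of_Ico fun _ => hR m
  have hcont : ∀ r ∈ unitBox n, Continuous fun ζ : Torus n => u (polar r ζ) := fun r hr =>
    continuous_polar_comp hu.1.continuousOn hr
  -- Convergence along a nonprincipal ultrafilter replaces extraction of a weakly convergent
  -- subsequence.
  obtain ⟨ψ, hψ, hlim⟩ := exists_tendsto_integral_mul_continuous (hyperfilter ℕ) hp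
    (f := fun m => dilate u (R m)) (fun m => (hcont _ (hbox m)).aestronglyMeasurable) hbdd.ne
    fun m => le_iSup₂ (f := fun (r : ℝ) (_ : r ∈ Ico (0 : ℝ) 1) =>
      eLpNorm (dilate u r) p (torusHaar n)) (R m) (hR m)
  have hψi : Integrable ψ (torusHaar n) := hψ.integrable hp.le
  have hRU : Tendsto R (hyperfilter ℕ) (𝓝[<] 1) := hRlim.mono_left Nat.hyperfilter_le_atTop
  refine ⟨ψ, hψ, eqOn_polydisc_of_coeff_eq hcont
    (fun r hr => continuous_poissonIntegralAB_polar α β hψi hr) fun k r hr => ?_⟩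
  rw [coeff_poissonIntegralAB α β hψi k (mem_unitBox_of_Ico hr), mul_comm]
  have h1 : Tendsto (fun m => coeff u k fun _ => R m) (hyperfilter ℕ)
      (𝓝 (∫ η, ψ η * chi (-k) η ∂(torusHaar n))) := hlim _ (continuous_chi (-k))
  have h2 := ((tendsto_prod_radialCoeff hre hα hβ k).comp hRU).const_mul (coeff u k r)
  rw [mul_one] at h2
  -- Both sides of `coeff_mul_prod` are taken to the limit with one set of radii equal to `(R m, …,
  -- R m)`: one side tends to `ψ̂(k)` times the kernel coefficients at `r`, the other to the
  -- coefficient of `u` at `r`.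
  refine tendsto_nhds_unique h2 ((h1.mul_const _).congr fun m => ?_)
  exact coeff_mul_prod hu k (fun j => isSepHarmonic_discKernel (α j) (β j)) hr fun _ => hR m

end Representation

theorem theorem3p14 (n : ℕ) (α β : Fin n → ℂ)
    (hre : ∀ j, -1 < (α j).re + (β j).re)
    (hα : ∀ j, ∀ k : ℕ, α j ≠ -((k : ℂ) + 1))
    (hβ : ∀ j, ∀ k : ℕ, β j ≠ -((k : ℂ) + 1))
    (p : ℝ≥0∞) (hp : 1 < p)
    (u : (Fin n → ℂ) → ℂ) (hu : IsSepHarmonic α β u)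
    (hbdd : (⨆ r ∈ Set.Ico (0 : ℝ) 1, eLpNorm (dilate u r) p (torusHaar n)) < ⊤) :
    ∃! ψ : Lp ℂ p (torusHaar n), ∀ z ∈ polydisc n, u z = poissonIntegralAB α β ψ z := by
  obtain ⟨ψ, hψ, hrep⟩ := exists_memLp_eq_poissonIntegralAB hre hα hβ hp hu hbdd
  refine ⟨hψ.toLp ψ, fun z hz => ?_, fun φ hφ => ?_⟩
  · rw [poissonIntegralAB_congr_ae hψ.coeFn_toLp]
    exact hrep z hz
  · refine Lp.ext ((poissonIntegralAB_injective hre hα hβ ((Lp.memLp φ).integrable hp.le)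
      (hψ.integrable hp.le) fun z hz => ?_).trans hψ.coeFn_toLp.symm)
    rw [← hφ z hz, hrep z hz]
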